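/- For $n, m \ge 0$ let $\mathrm{Conf}_n(\mathbb{CP}^1)$ be the variety of unordered $n$-tuples of distinct points of $\mathbb{CP}^1$, let $\mathrm{Conf}_{n,m}(\mathbb{CP}^1)$ be the variety of configurations of $n+m$ distinct points of $\mathbb{CP}^1$ divided into a group of $n$ old points and a group of $m$ new points, and consider the map $\mathrm{Conf}_{n,m}(\mathbb{CP}^1) \to \mathrm{Conf}_n(\mathbb{CP}^1)$ that forgets the new points. A section of this map is conformally invariant if it is equivariant for the action of $\mathrm{PGL}_2(\mathbb{C})$. For $k \ge 1$ let $P(k)$ be the number of primitive elements of $(\mathbb{Z}/k\mathbb{Z})^2$, that is, of elements of order exactly $k$. Proposition. Let $m$ be a positive integer of the form $m = 2k^2 - 2$ or $m = P(4k)/2$. Then $\mathrm{Conf}_{4,m}(\mathbb{CP}^1) \to \mathrm{Conf}_4(\mathbb{CP}^1)$ has a conformally invariant section $\sigma$ that is an algebraic map (a regular map of varieties). More precisely, $\sigma$ can be chosen as follows. For every $S \in \mathrm{Conf}_4(\mathbb{CP}^1)$ there is a complex elliptic curve $E$ with a quotient map $\iota : E \to \mathbb{CP}^1$ by the elliptic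 involution $x \mapsto -x$ whose branch locus is $S$; and for every such $E$ and $\iota$, the set of new points of $\sigma(S)$ is $\iota(E[2k] \setminus E[2])$ if $m = 2k^2 - 2$, respectively the image under $\iota$ of the set of points of order exactly $4k$ if $m = P(4k)/2$. -/

import Mathlib

open scoped LinearAlgebra.Projectivization MatrixGroups

namespace ConfCP1

noncomputable section

/-- The complex projective line; `[a : b]` is the line spanned by `![a, b]`. -/
abbrev CP1 : Type := ℙ ℂ (Fin 2 → ℂ)

/-- `Conf_n(CP¹)`: unordered `n`-tuples of distinct points. -/
def Conf (n : ℕ) : Type := {S : Finset CP1 // S.card = n}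

/-- `Conf_{n,m}(CP¹)`: configurations of `n + m` distinct points, divided into a group of `n`
(the old points, first component) and a group of `m` (the new points, second component). -/
def Conf₂ (n m : ℕ) : Type :=
  {T : Conf n × Conf m // Disjoint T.1.val T.2.val}

/-- The forgetful map `Conf_{n,m}(CP¹) → Conf_n(CP¹)`. -/
def Conf₂.old {n m : ℕ} (T : Conf₂ n m) : Conf n := T.val.1

/-- The new points of an element of `Conf_{n,m}(CP¹)`. -/
def Conf₂.new {n m : ℕ} (T : Conf₂ n m) : Conf m := T.val.2

/-- The action of `PGL₂(ℂ) = Aut(CP¹)` on `Conf_n(CP¹)`. -/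
def Conf.act {n : ℕ} (g : PGL(2, ℂ)) (S : Conf n) : Conf n :=
  ⟨S.val.map (MulAction.toPerm g).toEmbedding, by rw [Finset.card_map, S.property]⟩

/-- The (diagonal) action of `PGL₂(ℂ)` on `Conf_{n,m}(CP¹)`. -/
def Conf₂.act {n m : ℕ} (g : PGL(2, ℂ)) (T : Conf₂ n m) : Conf₂ n m :=
  ⟨(T.old.act g, T.new.act g), (Finset.disjoint_map _).2 T.property⟩

/-! ### The structure of algebraic variety

`Conf_n(CP¹)` is an open subvariety of `Sym^n(CP¹)`, and `Sym^n(CP¹)` is identified with `ℙⁿ`,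
the space of nonzero binary forms of degree `n` up to scaling, by sending `{p₁, …, pₙ}` to the form
`∏ (bᵢ X - aᵢ Y)`, where `pᵢ = [aᵢ : bᵢ]`. The space `Conf_{n,m}(CP¹)` is in the same way an open
subvariety of `ℙⁿ × ℙᵐ`. -/

/-- The linear form `b X - a Y`, whose only zero is `p = [a : b]`. -/
def linForm (p : CP1) : MvPolynomial (Fin 2) ℂ :=
  MvPolynomial.C (p.rep 1) * MvPolynomial.X 0 - MvPolynomial.C (p.rep 0) * MvPolynomial.X 1

/-- The binary form whose zeros are the points of `S`, each of multiplicity one. -/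
def binForm {n : ℕ} (S : Conf n) : MvPolynomial (Fin 2) ℂ := ∏ p ∈ S.val, linForm p

/-- The coefficients of `binForm S`: the `i`-th one belongs to `X ^ i * Y ^ (n - i)`. -/
def coeffs {n : ℕ} (S : Conf n) : Fin (n + 1) → ℂ := fun i =>
  (binForm S).coeff (Finsupp.single 0 (i : ℕ) + Finsupp.single 1 (n - (i : ℕ)))

theorem linForm_ne_zero (p : CP1) : linForm p ≠ 0 := by
  intro h
  apply p.rep_nonzero
  have h0 := congrArg (MvPolynomial.eval ![1, 0]) h
  have h1 := congrArg (MvPolynomial.eval ![0, 1]) h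
  simp [linForm] at h0 h1
  ext i
  fin_cases i
  · simpa using h1
  · simpa using h0

theorem linForm_isHomogeneous (p : CP1) : (linForm p).IsHomogeneous 1 :=
  (MvPolynomial.isHomogeneous_C_mul_X _ _).sub (MvPolynomial.isHomogeneous_C_mul_X _ _)

theorem binForm_isHomogeneous {n : ℕ} (S : Conf n) : (binForm S).IsHomogeneous n := by
  have h := MvPolynomial.IsHomogeneous.prod S.val linForm (fun _ => 1)
    (fun p _ => linForm_isHomogeneous p)
  simpa [binForm, S.property] using h

theorem coeffs_ne_zero {n : ℕ} (S : Conf n) : coeffs S ≠ 0 := by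
  intro h
  have hne : binForm S ≠ 0 := Finset.prod_ne_zero_iff.2 fun p _ => linForm_ne_zero p
  obtain ⟨d, hd⟩ := MvPolynomial.ne_zero_iff.1 hne
  have hdeg : d.degree = n := by
    by_contra hc
    exact hd ((binForm_isHomogeneous S).coeff_eq_zero hc)
  have hsum : d 0 + d 1 = n := by
    rw [← hdeg, Finsupp.degree_eq_sum]
    simp
  apply hd
  have hi := congrFun h ⟨d 0, by omega⟩
  have hde : d = Finsupp.single 0 (d 0) + Finsupp.single 1 (n - d 0) := by
    ext i
    fin_cases i
    · simp
    · simp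
      omega
  rw [hde]
  simpa [coeffs] using hi

/-- The embedding of `Conf_n(CP¹)` in `ℙⁿ`, as the complement of the discriminant hypersurface. -/
def Conf.toProj {n : ℕ} (S : Conf n) : ℙ ℂ (Fin (n + 1) → ℂ) :=
  Projectivization.mk ℂ (coeffs S) (coeffs_ne_zero S)

/-- Regular maps in the sense of classical algebraic geometry, for a set `X` that lies in a
projective space through `e`: around each point of `X` there is a Zariski open set `{D ≠ 0}` on
which `f : X → ℙᴺ` is given by homogeneous polynomials `Q₀, …, Q_N` of one common degree, without
a common zero there. -/
def IsRegular {n N : ℕ} {X : Type} (e : X → ℙ ℂ (Fin (n + 1) → ℂ))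
    (f : X → ℙ ℂ (Fin (N + 1) → ℂ)) : Prop :=
  ∀ x₀ : X, ∃ (D : MvPolynomial (Fin (n + 1)) ℂ) (Q : Fin (N + 1) → MvPolynomial (Fin (n + 1)) ℂ)
    (c d : ℕ), D.IsHomogeneous c ∧ (∀ j, (Q j).IsHomogeneous d) ∧
    MvPolynomial.eval (e x₀).rep D ≠ 0 ∧
    ∀ x : X, MvPolynomial.eval (e x).rep D ≠ 0 →
      ∃ h : (fun j => MvPolynomial.eval (e x).rep (Q j)) ≠ 0,
        f x = Projectivization.mk ℂ (fun j => MvPolynomial.eval (e x).rep (Q j)) h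

/-- Algebraic maps `Conf_n(CP¹) → Conf_{n,m}(CP¹) ⊆ ℙⁿ × ℙᵐ`: a map to a product of varieties is
regular when both of its components are. -/
def IsAlgebraic {n m : ℕ} (σ : Conf n → Conf₂ n m) : Prop :=
  IsRegular Conf.toProj (fun S => (σ S).old.toProj) ∧
  IsRegular Conf.toProj (fun S => (σ S).new.toProj)

/-- `σ` is a section of the forgetful map `Conf_{n,m}(CP¹) → Conf_n(CP¹)`. -/
def IsSection {n m : ℕ} (σ : Conf n → Conf₂ n m) : Prop := ∀ S, (σ S).old = S

/-- Conformal invariance: equivariance under `PGL₂(ℂ)`. -/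
def IsConformallyInvariant {n m : ℕ} (σ : Conf n → Conf₂ n m) : Prop :=
  ∀ (g : PGL(2, ℂ)) (S : Conf n), σ (S.act g) = (σ S).act g

/-! ### Elliptic curves as double covers of the projective line -/

/-- The `x`-coordinate of a complex elliptic curve, as a map to `CP¹`; it is the quotient map by
`P ↦ -P`, and the identity element goes to `[1 : 0]`. -/
def xMap (W : WeierstrassCurve ℂ) : W.toAffine.Point → CP1
  | .zero => Projectivization.mk ℂ ![1, 0] (by simp)
  | .some x _ _ => Projectivization.mk ℂ ![x, 1] (by simp)

/-- The quotient maps `ι : E → CP¹` by the elliptic involution `P ↦ -P`, for all identifications of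
the quotient with `CP¹`: the `x`-coordinate followed by an automorphism `g` of `CP¹`. -/
def doubleCover (W : WeierstrassCurve ℂ) (g : PGL(2, ℂ)) (P : W.toAffine.Point) : CP1 :=
  g • xMap W P

/-- The branch locus of the double cover `ι`: the points with a single preimage. -/
def branchLocus (W : WeierstrassCurve ℂ) (g : PGL(2, ℂ)) : Set CP1 :=
  {z | ∃! P : W.toAffine.Point, doubleCover W g P = z}

/-- For every configuration `S` of four points there is an elliptic curve `E` with a quotient map
`ι : E → CP¹` branched exactly over `S`, and for every such curve and map the new points of `σ S`
are the images under `ι` of the points of `E` that satisfy `tors`. -/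
def NewPointsAre {m : ℕ} (σ : Conf 4 → Conf₂ 4 m)
    (tors : ∀ W : WeierstrassCurve ℂ, W.toAffine.Point → Prop) : Prop :=
  ∀ S : Conf 4,
    (∃ (W : WeierstrassCurve ℂ) (g : PGL(2, ℂ)), W.IsElliptic ∧
      branchLocus W g = (S.val : Set CP1)) ∧
    ∀ (W : WeierstrassCurve ℂ) (g : PGL(2, ℂ)), W.IsElliptic →
      branchLocus W g = (S.val : Set CP1) →
      ((σ S).new.val : Set CP1) = doubleCover W g '' {P | tors W P}

/-- `P(k)`: the number of primitive elements of `(ℤ/kℤ)²`, that is, of elements of order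
exactly `k`. -/
def numPrimitive (k : ℕ) : ℕ := Nat.card {v : ZMod k × ZMod k // addOrderOf v = k}

end

end ConfCP1

/-! Let `f` be the binary quartic form with zero set `S`, and let `ι : E → CP¹` be a double cover
branched over `S`. The cover depends on which point of `S` is the image of the origin, so an
intrinsic set of new points must come from a subset of `E` stable under translation by `E[2]`, that
is, from a condition on `2P`. Both sets of the theorem are of this kind: `P ∈ E[2k] \ E[2]` means
that the order of `2P` divides `k` and is not `1`, and `P` has order `4k` exactly when `2P` has
order `2k`. It remains to treat the points for which the order of `2P` lies in a finite set `O` of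
integers `≥ 2` (`exists_section_of_orders`).

Classical invariant theory expresses `x(2P)` through covariants. The Hessian `H`, the sextic
covariant `T` and the invariants `I`, `J` of `f` satisfy `27 T² = H³ - 48 I f² H - 64 J f³`
(`syzygy`). Hence `t = 3H / (4f)` behaves as an `X`-coordinate on `Y² = X³ - 27 I X - 27 J`, the
Jacobian of `y² = f`. If this curve is identified with `E`, then `t(ι(P))` is `x(2P)`
(`form_eq_of_transform`, `hessian_eq_of_transform`).

The monic polynomial `L` whose simple roots are the `x`-coordinates of the points of given order has
coefficients that are polynomials in those of `f` (`exists_primitiveDivisionPolynomial`).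
Homogenizing `L(3H / 4f)` gives a form that vanishes at the wanted points. For order two the zeros
would be double, since the cubic of the curve, evaluated at `t`, is `T² / f³` up to a constant; `T`
itself is used instead. With `|E[n]| = n²` (`ncard_torsion`) the degree of the resulting form equals
the number of its zeros (`two_mul_degree_eq`), so it is, up to a constant, the product of the linear
forms of the new points. Therefore the new points depend algebraically on `S`, and they do not
depend on `E` and `ι`. Equivariance follows, because `h ∘ ι` is a double cover branched over `h(S)`.

The arithmetic of `E` is done on `x`-coordinates: polynomials `p`, `q` of degrees `n²` and `n² - 1`
with `x(nP) = p/q` come from duplication and differential addition (`exists_evalPair_xMul`). -/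

/-! ### Sums and differences of points on `x`-coordinates. -/

namespace WeierstrassCurve.Affine.Point

variable {F : Type*} [Field F]

/-- The biquadratic map `addSubMap`, evaluated at a triple. -/
lemma eval_addSubMap {R : Type*} [CommRing R] (W : WeierstrassCurve R) (v : Fin 3 → R) :
    (fun i => (W.addSubMap i).eval v) =
      ![v 0 ^ 2 - W.b₄ * v 0 * v 2 - W.b₆ * v 1 * v 2 - W.b₈ * v 2 ^ 2,
        2 * v 1 * v 0 + W.b₂ * v 0 * v 2 + W.b₄ * v 1 * v 2 + W.b₆ * v 2 ^ 2,
        v 1 ^ 2 - 4 * v 0 * v 2] := by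
  ext i
  fin_cases i <;> simp [addSubMap]

variable {W : WeierstrassCurve.Affine F}

lemma twoTorsion_eval_eq_sq {x y : F} (h : W.Equation x y) :
    4 * x ^ 3 + W.b₂ * x ^ 2 + 2 * W.b₄ * x + W.b₆ = (y - W.negY x y) ^ 2 := by
  rw [equation_iff] at h
  simp only [b₂, b₄, b₆, negY]
  linear_combination -4 * h

variable [DecidableEq F]

/-- The duplication formula. At a point of order two the third coordinate and the cubic `4x³ + b₂x²
+ 2b₄x + b₆ = (y - negY)²` vanish, which leaves a multiple of the class of `{∞, ∞}`; elsewhere that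
square is the denominator of `x(2P)` and serves as the factor. -/
lemma addSubMap_sym2x_self (P : W.Point) :
    ∃ c : F, (fun i => (addSubMap W i).eval (P.sym2x P)) = c • (P + P).sym2x 0 := by
  rcases P with _ | ⟨x, y, h⟩
  · refine ⟨1, ?_⟩
    rw [← zero_def, eval_addSubMap]
    ext i
    fin_cases i <;> simp
  · rw [eval_addSubMap]
    have he := (equation_iff ..).1 h.1
    have hs := twoTorsion_eval_eq_sq h.1
    by_cases hy : y = W.negY x y
    · rw [add_self_of_Y_eq hy]
      rw [← sub_eq_zero] at hy
      rw [hy] at hs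
      refine ⟨(x * x) ^ 2 - WeierstrassCurve.b₄ W * (x * x) - WeierstrassCurve.b₆ W * (x + x) -
        WeierstrassCurve.b₈ W, ?_⟩
      ext i
      fin_cases i
      · simp
      · simp
        linear_combination hs
      · simp
        ring
    · rw [add_self_of_Y_ne hy, sym2x_some_zero, slope_of_Y_ne rfl hy]
      refine ⟨(y - W.negY x y) ^ 2, ?_⟩
      have hy' : y - W.negY x y ≠ 0 := sub_ne_zero.2 hy
      ext i
      fin_cases i
      · simp [addX, -negY]
        field_simp
        simp only [b₄, b₆, b₈, negY]
        linear_combination (W.a₁ ^ 2 + 4 * W.a₂ + 8 * x) * he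
      · simp [-negY]
        linear_combination hs
      · simp
        ring

lemma addSubMap_sym2x_of_X_ne {x₁ y₁ x₂ y₂ : F} (h₁ : W.Nonsingular x₁ y₁)
    (h₂ : W.Nonsingular x₂ y₂) (hx : x₁ ≠ x₂) :
    (fun i => (addSubMap W i).eval ((some _ _ h₁).sym2x (some _ _ h₂))) =
      (x₁ - x₂) ^ 2 • (some _ _ h₁ + some _ _ h₂).sym2x (some _ _ h₁ - some _ _ h₂) := by
  have hd : x₁ - x₂ ≠ 0 := sub_ne_zero.2 hx
  have he₁ := (equation_iff ..).1 h₁.1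
  have he₂ := (equation_iff ..).1 h₂.1
  rw [eval_addSubMap, sub_eq_add_neg (some _ _ h₁), neg_some, add_of_X_ne hx, add_of_X_ne hx,
    sym2x_some_some, sym2x_some_some, slope_of_X_ne hx, slope_of_X_ne hx]
  simp only [addX]
  ext i
  fin_cases i
  · simp [-negY]
    field_simp
    -- The product of the numerators of `x(P + Q)` and `x(P - Q)`, arranged so that `y₁`, `y₂` occur
    -- on the right only through the left sides of the two Weierstrass equations, which can then be
    -- substituted.
    have key : ((y₁ - y₂) ^ 2 + W.a₁ * (y₁ - y₂) * (x₁ - x₂) - (x₁ - x₂) ^ 2 * (W.a₂ + x₁ + x₂)) *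
        ((y₁ - W.negY x₂ y₂) ^ 2 + W.a₁ * (y₁ - W.negY x₂ y₂) * (x₁ - x₂) -
          (x₁ - x₂) ^ 2 * (W.a₂ + x₁ + x₂)) =
        ((y₁ ^ 2 + W.a₁ * x₁ * y₁ + W.a₃ * y₁) + (y₂ ^ 2 + W.a₁ * x₂ * y₂ + W.a₃ * y₂) -
          (x₁ - x₂) ^ 2 * (W.a₂ + x₁ + x₂)) ^ 2 +
        ((y₁ ^ 2 + W.a₁ * x₁ * y₁ + W.a₃ * y₁) + (y₂ ^ 2 + W.a₁ * x₂ * y₂ + W.a₃ * y₂) -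
          (x₁ - x₂) ^ 2 * (W.a₂ + x₁ + x₂)) * ((W.a₁ * x₁ + W.a₃) * (W.a₁ * x₂ + W.a₃)) -
        4 * (y₁ ^ 2 + W.a₁ * x₁ * y₁ + W.a₃ * y₁) * (y₂ ^ 2 + W.a₁ * x₂ * y₂ + W.a₃ * y₂) -
        (y₁ ^ 2 + W.a₁ * x₁ * y₁ + W.a₃ * y₁) * (W.a₁ * x₂ + W.a₃) ^ 2 -
        (y₂ ^ 2 + W.a₁ * x₂ * y₂ + W.a₃ * y₂) * (W.a₁ * x₁ + W.a₃) ^ 2 := by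
      simp only [negY]
      ring
    rw [he₁, he₂] at key
    simp only [b₄, b₆, b₈]
    linear_combination -key
  · simp [-negY]
    field_simp
    simp only [b₂, b₄, b₆, negY]
    linear_combination -2 * he₁ - 2 * he₂
  · simp
    ring

/-- The map `addSubMap` describes `{x(P), x(Q)} ↦ {x(P + Q), x(P - Q)}`. -/
theorem exists_addSubMap_sym2x_eq_smul (P Q : W.Point) :
    ∃ c : F, (fun i => (addSubMap W i).eval (P.sym2x Q)) = c • (P + Q).sym2x (P - Q) := by
  rcases P with _ | ⟨x₁, y₁, h₁⟩
  · rw [← zero_def, zero_add, zero_sub, sym2x_neg_right, eval_addSubMap]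
    rcases Q with _ | ⟨x₂, y₂, h₂⟩
    · refine ⟨1, ?_⟩
      rw [← zero_def]
      ext i
      fin_cases i <;> simp
    · refine ⟨1, ?_⟩
      ext i
      fin_cases i <;> simp <;> ring
  · rcases Q with _ | ⟨x₂, y₂, h₂⟩
    · rw [← zero_def, add_zero, sub_zero, eval_addSubMap]
      refine ⟨1, ?_⟩
      ext i
      fin_cases i <;> simp <;> ring
    · by_cases hx : x₁ = x₂
      · rcases X_eq_iff.1 hx with h | h
        · rw [h, sub_self]
          exact addSubMap_sym2x_self _
        · obtain ⟨c, hc⟩ := addSubMap_sym2x_self (some x₂ y₂ h₂)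
          refine ⟨c, ?_⟩
          rw [h, sym2x_neg_left, hc, neg_add_cancel, ← neg_add', sym2x_neg_right, sym2x_comm]
      · exact ⟨_, addSubMap_sym2x_of_X_ne h₁ h₂ hx⟩

end WeierstrassCurve.Affine.Point

/-! ### Multiplication by `n` on `x`-coordinates. -/

namespace WeierstrassCurve

open Polynomial

section Definition

variable {R : Type*} [CommRing R] (W : WeierstrassCurve R)

/-- Doubling on `x`-coordinates, in homogeneous form. -/
noncomputable def xDouble (a : R[X] × R[X]) : R[X] × R[X] :=
  (a.1 ^ 4 - C W.b₄ * a.1 ^ 2 * a.2 ^ 2 - 2 * C W.b₆ * a.1 * a.2 ^ 3 - C W.b₈ * a.2 ^ 4,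
    4 * a.1 ^ 3 * a.2 + C W.b₂ * a.1 ^ 2 * a.2 ^ 2 + 2 * C W.b₄ * a.1 * a.2 ^ 3 +
      C W.b₆ * a.2 ^ 4)

/-- The `x`-coordinate of `P + Q`, in homogeneous form, from those of `P` and `Q`, if `P - Q` has
`x`-coordinate `X`. -/
noncomputable def xAdd (a a' : R[X] × R[X]) : R[X] × R[X] :=
  let s := a.1 * a'.1
  let t := a.1 * a'.2 + a'.1 * a.2
  let u := a.2 * a'.2
  (2 * t * s + C W.b₂ * s * u + C W.b₄ * t * u + C W.b₆ * u ^ 2 - X * (t ^ 2 - 4 * s * u),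
    t ^ 2 - 4 * s * u)

/-- Polynomials `(p, q)` such that `p / q` is the `x`-coordinate of `n • P`, as a function of the
`x`-coordinate of `P`. -/
noncomputable def xMul : ℕ → R[X] × R[X]
  | 0 => (1, 0)
  | 1 => (X, 1)
  | (n + 2) => let m := n / 2 + 1
    if hn : Even n then W.xDouble (xMul m) else
      have : m + 1 < n + 2 :=
        add_lt_add_left (Nat.div_lt_self (Nat.not_even_iff_odd.mp hn).pos one_lt_two) 2
      W.xAdd (xMul m) (xMul (m + 1))

@[simp]
lemma xMul_zero : W.xMul 0 = (1, 0) := by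
  rw [xMul]

@[simp]
lemma xMul_one : W.xMul 1 = (X, 1) := by
  rw [xMul]

lemma xMul_two_mul {n : ℕ} (hn : n ≠ 0) : W.xMul (2 * n) = W.xDouble (W.xMul n) := by
  obtain ⟨n, rfl⟩ := Nat.exists_eq_succ_of_ne_zero hn
  rw [show 2 * n.succ = 2 * n + 2 by rfl, xMul, dif_pos (even_two_mul n)]
  simp

lemma xMul_two : W.xMul 2 = W.xDouble (X, 1) := by
  simpa using W.xMul_two_mul one_ne_zero

lemma xMul_two_mul_add_one {n : ℕ} (hn : n ≠ 0) :
    W.xMul (2 * n + 1) = W.xAdd (W.xMul n) (W.xMul (n + 1)) := by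
  obtain ⟨n, rfl⟩ := Nat.exists_eq_succ_of_ne_zero hn
  rw [show 2 * n.succ + 1 = 2 * n + 1 + 2 by rfl, xMul, dif_neg (by simp)]
  simp [show (2 * n + 1) / 2 = n by lia]

/-- Induction along the recursion that defines `xMul`. -/
theorem xMul_induction {motive : ℕ → Prop} (zero : motive 0) (one : motive 1)
    (even : ∀ n, n ≠ 0 → motive n → motive (2 * n))
    (odd : ∀ n, n ≠ 0 → motive n → motive (n + 1) → motive (2 * n + 1)) (n : ℕ) : motive n := by
  induction n using Nat.strong_induction_on with
  | _ n ih =>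
    obtain ⟨m, rfl | rfl⟩ := Nat.even_or_odd' n
    · rcases eq_or_ne m 0 with rfl | hm
      · exact zero
      · exact even m hm (ih m (by lia))
    · rcases eq_or_ne m 0 with rfl | hm
      · exact one
      · exact odd m hm (ih m (by lia)) (ih (m + 1) (by lia))

lemma map_xMul {S : Type*} [CommRing S] (f : R →+* S) (n : ℕ) :
    (W.map f).xMul n = ((W.xMul n).1.map f, (W.xMul n).2.map f) := by
  induction n using xMul_induction with
  | zero => simp
  | one => simp
  | even n hn ih => simp [xMul_two_mul _ hn, ih, xDouble]
  | odd n hn ih ih' => simp [xMul_two_mul_add_one _ hn, ih, ih', xAdd]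

end Definition

/-! ### Degrees and leading coefficients of the multiplication polynomials. -/

section Degree

variable {R : Type*} [CommRing R]

/-- `f` has degree at most `d`, and `c` is its coefficient in degree `d`. -/
def HasTop (d : ℕ) (c : R) (f : R[X]) : Prop := f.natDegree ≤ d ∧ f.coeff d = c

namespace HasTop

variable {d e : ℕ} {a b : R} {f g : R[X]}

lemma congr (hf : HasTop d a f) (hd : d = e) (ha : a = b) : HasTop e b f := hd ▸ ha ▸ hf

lemma mul (hf : HasTop d a f) (hg : HasTop e b g) : HasTop (d + e) (a * b) (f * g) :=
  ⟨natDegree_mul_le_of_le hf.1 hg.1, by rw [coeff_mul_add_eq_of_natDegree_le hf.1 hg.1, hf.2, hg.2]⟩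

lemma pow (hf : HasTop d a f) (n : ℕ) : HasTop (n * d) (a ^ n) (f ^ n) :=
  ⟨natDegree_pow_le_of_le n hf.1, by
    rw [coeff_pow_of_natDegree_le hf.1, hf.2]⟩

lemma add (hf : HasTop d a f) (hg : HasTop d b g) : HasTop d (a + b) (f + g) :=
  ⟨natDegree_add_le_of_degree_le hf.1 hg.1, by rw [coeff_add, hf.2, hg.2]⟩

lemma sub (hf : HasTop d a f) (hg : HasTop d b g) : HasTop d (a - b) (f - g) :=
  ⟨(natDegree_sub_le _ _).trans (max_le hf.1 hg.1), by rw [coeff_sub, hf.2, hg.2]⟩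

lemma raise (hf : HasTop d a f) (h : d < e) : HasTop e 0 f :=
  ⟨hf.1.trans h.le, coeff_eq_zero_of_natDegree_lt (hf.1.trans_lt h)⟩

lemma C (a : R) : HasTop 0 a (C a) := by simp [HasTop]

lemma X : HasTop 1 (1 : R) X := ⟨natDegree_X_le, coeff_X_one⟩

lemma ofNat (n : ℕ) [n.AtLeastTwo] : HasTop 0 (OfNat.ofNat n : R) (OfNat.ofNat n : R[X]) := by
  simp [HasTop]

end HasTop

variable (W : WeierstrassCurve R)

lemma HasTop.xDouble {d : ℕ} {c : R} {a : R[X] × R[X]} (h₁ : HasTop (d + 1) 1 a.1)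
    (h₂ : HasTop d c a.2) :
    HasTop (4 * d + 4) 1 (W.xDouble a).1 ∧ HasTop (4 * d + 3) (4 * c) (W.xDouble a).2 := by
  constructor
  · have e₁ := (h₁.pow 4).congr (e := 4 * d + 4) (b := 1) (by ring) (by ring)
    have e₂ := (((HasTop.C W.b₄).mul (h₁.pow 2)).mul (h₂.pow 2)).raise (e := 4 * d + 4) (by lia)
    have e₃ := ((((HasTop.ofNat 2).mul (HasTop.C W.b₆)).mul h₁).mul (h₂.pow 3)).raise
      (e := 4 * d + 4) (by lia)
    have e₄ := ((HasTop.C W.b₈).mul (h₂.pow 4)).raise (e := 4 * d + 4) (by lia)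
    exact (((e₁.sub e₂).sub e₃).sub e₄).congr rfl (by ring)
  · have e₁ := (((HasTop.ofNat 4).mul (h₁.pow 3)).mul h₂).congr (e := 4 * d + 3) (b := 4 * c)
      (by ring) (by ring)
    have e₂ := (((HasTop.C W.b₂).mul (h₁.pow 2)).mul (h₂.pow 2)).raise (e := 4 * d + 3) (by lia)
    have e₃ := ((((HasTop.ofNat 2).mul (HasTop.C W.b₄)).mul h₁).mul (h₂.pow 3)).raise
      (e := 4 * d + 3) (by lia)
    have e₄ := ((HasTop.C W.b₆).mul (h₂.pow 4)).raise (e := 4 * d + 3) (by lia)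
    exact (((e₁.add e₂).add e₃).add e₄).congr rfl (by ring)

lemma HasTop.xAdd {d d' : ℕ} {c c' : R} {a a' : R[X] × R[X]} (h₁ : HasTop (d + 1) 1 a.1)
    (h₂ : HasTop d c a.2) (h₁' : HasTop (d' + 1) 1 a'.1) (h₂' : HasTop d' c' a'.2) :
    HasTop (2 * d + 2 * d' + 3) (2 * (c + c') - (c - c') ^ 2) (W.xAdd a a').1 ∧
      HasTop (2 * d + 2 * d' + 2) ((c - c') ^ 2) (W.xAdd a a').2 := by
  have hs := (h₁.mul h₁').congr (e := d + d' + 2) (b := 1) (by ring) (by ring)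
  have ht := ((h₁.mul h₂').congr (e := d + d' + 1) (b := c') (by ring) (by ring)).add
    ((h₁'.mul h₂).congr (e := d + d' + 1) (b := c) (by ring) (by ring))
  have hu := h₂.mul h₂'
  have h := ((ht.pow 2).congr (e := 2 * d + 2 * d' + 2) (by ring) rfl).sub
    ((((HasTop.ofNat 4).mul hs).mul hu).congr (e := 2 * d + 2 * d' + 2) (by ring) rfl)
  refine ⟨?_, h.congr rfl (by ring)⟩
  have e₁ := (((HasTop.ofNat 2).mul ht).mul hs).congr (e := 2 * d + 2 * d' + 3) (by ring) rfl
  have e₂ := (((HasTop.C W.b₂).mul hs).mul hu).raise (e := 2 * d + 2 * d' + 3) (by lia)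
  have e₃ := (((HasTop.C W.b₄).mul ht).mul hu).raise (e := 2 * d + 2 * d' + 3) (by lia)
  have e₄ := ((HasTop.C W.b₆).mul (hu.pow 2)).raise (e := 2 * d + 2 * d' + 3) (by lia)
  have e₅ := (HasTop.X.mul h).congr (e := 2 * d + 2 * d' + 3) (by ring) rfl
  exact ((((e₁.add e₂).add e₃).add e₄).sub e₅).congr rfl (by ring)

/-- Near infinity `x(nP)` behaves like `x / n²`. The odd step rests on `((n + 1)² - n²)² = (2n +
1)²`. Writing the degree as `d + 1 = n ^ 2` avoids truncated subtraction in the recursion. -/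
lemma hasTop_xMul_succ (n : ℕ) (hn : n ≠ 0) : ∃ d, d + 1 = n ^ 2 ∧
    HasTop (d + 1) 1 (W.xMul n).1 ∧ HasTop d ((n : R) ^ 2) (W.xMul n).2 := by
  induction n using xMul_induction with
  | zero => simp at hn
  | one => exact ⟨0, rfl, by simpa using HasTop.X, by simpa using HasTop.C (1 : R)⟩
  | even n h₀ ih =>
    obtain ⟨d, hd, h₁, h₂⟩ := ih h₀
    obtain ⟨e₁, e₂⟩ := HasTop.xDouble W h₁ h₂
    rw [xMul_two_mul _ h₀]
    exact ⟨4 * d + 3, by linarith, e₁, e₂.congr rfl (by push_cast; ring)⟩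
  | odd n h₀ ih ih' =>
    obtain ⟨d, hd, h₁, h₂⟩ := ih h₀
    obtain ⟨d', hd', h₁', h₂'⟩ := ih' n.succ_ne_zero
    obtain ⟨e₁, e₂⟩ := HasTop.xAdd W h₁ h₂ h₁' h₂'
    rw [xMul_two_mul_add_one _ h₀]
    exact ⟨2 * d + 2 * d' + 2, by linarith, e₁.congr rfl (by push_cast; ring),
      e₂.congr rfl (by push_cast; ring)⟩

lemma natDegree_xMul_fst_le (n : ℕ) : (W.xMul n).1.natDegree ≤ n ^ 2 := by
  rcases eq_or_ne n 0 with rfl | hn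
  · simp
  · obtain ⟨d, hd, h, -⟩ := W.hasTop_xMul_succ n hn
    exact hd ▸ h.1

lemma coeff_xMul_fst (n : ℕ) : (W.xMul n).1.coeff (n ^ 2) = 1 := by
  rcases eq_or_ne n 0 with rfl | hn
  · simp
  · obtain ⟨d, hd, h, -⟩ := W.hasTop_xMul_succ n hn
    exact hd ▸ h.2

lemma hasTop_xMul_fst (n : ℕ) : HasTop (n ^ 2) 1 (W.xMul n).1 :=
  ⟨W.natDegree_xMul_fst_le n, W.coeff_xMul_fst n⟩

lemma hasTop_xMul_snd (n : ℕ) : HasTop (n ^ 2 - 1) ((n : R) ^ 2) (W.xMul n).2 := by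
  rcases eq_or_ne n 0 with rfl | hn
  · simp [HasTop]
  · obtain ⟨d, hd, -, h⟩ := W.hasTop_xMul_succ n hn
    rw [← hd]
    exact h

end Degree

/-! ### The multiplication polynomials compute multiples of points. -/

section Points

variable {F : Type*} [Field F] [DecidableEq F] (W : WeierstrassCurve F)

/-- The value at `x` of a pair of polynomials. -/
noncomputable def evalPair (a : F[X] × F[X]) (x : F) : Fin 2 → F := ![a.1.eval x, a.2.eval x]

variable {W} [W.IsElliptic]

open WeierstrassCurve.Affine WeierstrassCurve.Affine.Point

/-- `W.xMul n` gives the `x`-coordinate of `n • P`. -/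
theorem exists_evalPair_xMul {x y : F} (h : W.toAffine.Nonsingular x y) (n : ℕ) :
    ∃ c : F, c ≠ 0 ∧ evalPair (W.xMul n) x = c • (n • some x y h).xRep := by
  -- The factor is nonzero because `addSubMap` has no zero on nonzero triples when the discriminant
  -- is a unit. This is what keeps `p` and `q` from vanishing together.
  have main (k l : ℕ) : ∃ c : F, c ≠ 0 ∧ (fun i => (addSubMap W i).eval
      ((k • some x y h).sym2x (l • some x y h))) =
      c • ((k • some x y h) + (l • some x y h)).sym2x ((k • some x y h) - (l • some x y h)) := by
    obtain ⟨c, hc⟩ := exists_addSubMap_sym2x_eq_smul (k • some x y h) (l • some x y h)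
    refine ⟨c, ?_, hc⟩
    rintro rfl
    exact addSubMap_ne_zero W (sym2x_ne_zero _ _) (by rw [hc, zero_smul])
  induction n using xMul_induction with
  | zero => exact ⟨1, one_ne_zero, by simp [evalPair]⟩
  | one => exact ⟨1, one_ne_zero, by simp [evalPair]⟩
  | even n hn ih =>
    obtain ⟨c, hc, ih⟩ := ih
    obtain ⟨e, he, hm⟩ := main n n
    rw [sub_self, ← add_smul, ← two_mul, eval_addSubMap] at hm
    refine ⟨c ^ 4 * e, by positivity, ?_⟩
    have i0 := congrFun ih 0
    have i1 := congrFun ih 1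
    have m0 := congrFun hm 0
    have m1 := congrFun hm 1
    simp [evalPair, sym2x] at i0 i1 m0 m1
    rw [xMul_two_mul _ hn]
    ext i
    fin_cases i
    · simp [evalPair, xDouble, i0, i1]
      linear_combination c ^ 4 * m0
    · simp [evalPair, xDouble, i0, i1]
      linear_combination c ^ 4 * m1
  | odd n hn ih ih' =>
    obtain ⟨c, hc, ih⟩ := ih
    obtain ⟨c', hc', ih'⟩ := ih'
    obtain ⟨e, he, hm⟩ := main (n + 1) n
    have hsub : (n + 1) • some x y h - n • some x y h = some x y h := by
      rw [add_smul, one_smul, add_sub_cancel_left]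
    rw [hsub, ← add_smul, show n + 1 + n = 2 * n + 1 by ring, eval_addSubMap] at hm
    refine ⟨c ^ 2 * c' ^ 2 * e, by positivity, ?_⟩
    have i0 := congrFun ih 0
    have i1 := congrFun ih 1
    have j0 := congrFun ih' 0
    have j1 := congrFun ih' 1
    have m0 := congrFun hm 0
    have m1 := congrFun hm 1
    have m2 := congrFun hm 2
    simp [evalPair, sym2x] at i0 i1 j0 j1 m0 m1 m2
    rw [xMul_two_mul_add_one _ hn]
    ext i
    fin_cases i
    · simp [evalPair, xAdd, i0, i1, j0, j1]
      -- Here `P - Q` is the base point: the sum of the two `x`-coordinates minus the known one,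
      -- `x`, both over the common denominator `m2`.
      linear_combination c ^ 2 * c' ^ 2 * (m1 - x * m2)
    · simp [evalPair, xAdd, i0, i1, j0, j1]
      linear_combination c ^ 2 * c' ^ 2 * m2

end Points

section AffineChange

variable {F : Type*} [Field F] {W W' : WeierstrassCurve F} {a r : F}

/-- `xMul` is compatible with changes of variable `x' = a * (x - r)`. -/
theorem exists_evalPair_xMul_of_affine (ha : a ≠ 0) (h₂ : W'.b₂ = a * (W.b₂ + 12 * r))
    (h₄ : W'.b₄ = a ^ 2 * (W.b₄ + r * W.b₂ + 6 * r ^ 2))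
    (h₆ : W'.b₆ = a ^ 3 * (W.b₆ + 2 * r * W.b₄ + r ^ 2 * W.b₂ + 4 * r ^ 3))
    (h₈ : W'.b₈ = a ^ 4 * (W.b₈ + 3 * r * W.b₆ + 3 * r ^ 2 * W.b₄ + r ^ 3 * W.b₂ + 3 * r ^ 4))
    (x : F) (n : ℕ) : ∃ c : F, c ≠ 0 ∧
      (W'.xMul n).1.eval (a * (x - r)) =
        c * (a * ((W.xMul n).1.eval x - r * (W.xMul n).2.eval x)) ∧
      (W'.xMul n).2.eval (a * (x - r)) = c * (W.xMul n).2.eval x := by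
  induction n using xMul_induction with
  | zero => exact ⟨a⁻¹, inv_ne_zero ha, by simp [ha], by simp⟩
  | one => exact ⟨1, one_ne_zero, by simp, by simp⟩
  | even n hn ih =>
    obtain ⟨c, hc, ih₁, ih₂⟩ := ih
    refine ⟨c ^ 4 * a ^ 3, by positivity, ?_, ?_⟩
    · simp [xMul_two_mul _ hn, xDouble, ih₁, ih₂, h₂, h₄, h₆, h₈]
      ring
    · simp [xMul_two_mul _ hn, xDouble, ih₁, ih₂, h₂, h₄, h₆, h₈]
      ring
  | odd n hn ih ih' =>
    obtain ⟨c, hc, ih₁, ih₂⟩ := ih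
    obtain ⟨c', hc', ih₁', ih₂'⟩ := ih'
    refine ⟨c ^ 2 * c' ^ 2 * a ^ 2, by positivity, ?_, ?_⟩
    · simp [xMul_two_mul_add_one _ hn, xAdd, ih₁, ih₂, ih₁', ih₂', h₂, h₄, h₆]
      ring
    · simp [xMul_two_mul_add_one _ hn, xAdd, ih₁, ih₂, ih₁', ih₂', h₂, h₄, h₆]
      ring

end AffineChange

end WeierstrassCurve

/-! ### Counting elements of a given order. -/

section TorsionCount

lemma ncard_addOrderOf_mem_eq_sum {M : Type*} [AddMonoid M] {O : Finset ℕ}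
    (h : {a : M | addOrderOf a ∈ O}.Finite) :
    {a : M | addOrderOf a ∈ O}.ncard = ∑ d ∈ O, {a : M | addOrderOf a = d}.ncard := by
  classical
  rw [Set.ncard_eq_toFinset_card _ h, Finset.card_eq_sum_card_fiberwise (f := addOrderOf) (t := O)]
  · refine Finset.sum_congr rfl fun e he => ?_
    rw [← Set.ncard_coe_finset]
    congr 1
    ext a
    simp only [Finset.coe_filter, Set.Finite.mem_toFinset, Set.mem_ofPred_eq,
      and_iff_right_iff_imp]
    rintro rfl
    exact he
  · intro a ha
    simpa using ha

lemma ncard_torsion_eq_sum_ncard_addOrderOf {M : Type*} [AddMonoid M] {d : ℕ} (hd : d ≠ 0)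
    (hM : {a : M | d • a = 0}.Finite) :
    {a : M | d • a = 0}.ncard = ∑ e ∈ d.divisors, {a : M | addOrderOf a = e}.ncard := by
  have h : {a : M | d • a = 0} = {a : M | addOrderOf a ∈ d.divisors} := by
    ext a
    simp [hd, addOrderOf_dvd_iff_nsmul_eq_zero]
  rw [h] at hM ⊢
  exact ncard_addOrderOf_mem_eq_sum hM

/-- The number of elements of order `d` is determined by the numbers of elements killed by the
divisors of `d`. -/
theorem ncard_addOrderOf_eq_of_ncard_torsion_eq {A B : Type*} [AddMonoid A] [AddMonoid B] {n : ℕ}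
    (hn : n ≠ 0) (hA : ∀ d, d ∣ n → {a : A | d • a = 0}.Finite)
    (hB : ∀ d, d ∣ n → {b : B | d • b = 0}.Finite)
    (h : ∀ d, d ∣ n → {a : A | d • a = 0}.ncard = {b : B | d • b = 0}.ncard) :
    {a : A | addOrderOf a = n}.ncard = {b : B | addOrderOf b = n}.ncard := by
  have main (d : ℕ) : d ∣ n →
      {a : A | addOrderOf a = d}.ncard = {b : B | addOrderOf b = d}.ncard := by
    induction d using Nat.strong_induction_on with
    | _ d ih =>
      intro hd
      have hd0 : d ≠ 0 := fun h => hn (by simpa [h] using hd)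
      have hs := h d hd
      rw [ncard_torsion_eq_sum_ncard_addOrderOf hd0 (hA d hd),
        ncard_torsion_eq_sum_ncard_addOrderOf hd0 (hB d hd), ← Nat.cons_self_properDivisors hd0,
        Finset.sum_cons, Finset.sum_cons] at hs
      have : ∑ e ∈ d.properDivisors, {a : A | addOrderOf a = e}.ncard =
          ∑ e ∈ d.properDivisors, {b : B | addOrderOf b = e}.ncard :=
        Finset.sum_congr rfl fun e he => ih e (Nat.mem_properDivisors.1 he).2
          ((Nat.mem_properDivisors.1 he).1.trans hd)
      lia
  exact main n dvd_rfl

lemma ZMod.ncard_torsion_prod {n d : ℕ} [NeZero n] (hd : d ∣ n) :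
    {v : ZMod n × ZMod n | d • v = 0}.ncard = d ^ 2 := by
  have h : {a : ZMod n | d • a = 0}.ncard = d := by
    have := IsAddCyclic.card_nsmulAddMonoidHom_ker (ZMod n) d
    rw [Nat.card_zmod, Nat.gcd_eq_right hd] at this
    exact this
  have hp : {v : ZMod n × ZMod n | d • v = 0} =
      {a : ZMod n | d • a = 0} ×ˢ {a : ZMod n | d • a = 0} := by
    ext v
    simp [Prod.ext_iff]
  rw [hp, Set.ncard_prod, h, sq]

end TorsionCount

/-! ### The torsion of an elliptic curve. -/

namespace WeierstrassCurve

open Polynomial WeierstrassCurve.Affine WeierstrassCurve.Affine.Point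

variable {F : Type*} [Field F] [DecidableEq F] [IsAlgClosed F] [CharZero F]
  (W : WeierstrassCurve F) [W.IsElliptic]

omit [DecidableEq F] in
lemma exists_point (x : F) : ∃ y, W.toAffine.Nonsingular x y := by
  obtain ⟨s, hs⟩ := IsAlgClosed.exists_pow_nat_eq
    (4 * x ^ 3 + W.b₂ * x ^ 2 + 2 * W.b₄ * x + W.b₆) (n := 2) two_pos
  refine ⟨(s - W.a₁ * x - W.a₃) / 2, equation_iff_nonsingular.1 ?_⟩
  rw [equation_iff]
  simp only [b₂, b₄, b₆] at hs
  field_simp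
  linear_combination hs

variable {W}

omit [IsAlgClosed F] [CharZero F] in
lemma nsmul_some_eq_zero_iff {x y : F} (h : W.toAffine.Nonsingular x y) (n : ℕ) :
    n • some x y h = 0 ↔ (W.xMul n).2.eval x = 0 := by
  obtain ⟨c, hc, e⟩ := exists_evalPair_xMul h n
  have e₁ := congrFun e 1
  simp only [evalPair, Matrix.cons_val_one, Matrix.cons_val_zero, Pi.smul_apply, smul_eq_mul] at e₁
  rw [e₁]
  rcases n • some x y h with _ | ⟨x', y', h'⟩
  · simp [← zero_def]
  · simp [hc]

omit [IsAlgClosed F] [CharZero F] in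
lemma xRep_nsmul_some_eq_iff {x y : F} (h : W.toAffine.Nonsingular x y) (n : ℕ) (c : F) :
    (n • some x y h).xRep = ![c, 1] ↔ (W.xMul n).1.eval x = c * (W.xMul n).2.eval x := by
  obtain ⟨a, ha, e⟩ := exists_evalPair_xMul h n
  have e₀ := congrFun e 0
  have e₁ := congrFun e 1
  simp only [evalPair, Matrix.cons_val_one, Matrix.cons_val_zero, Pi.smul_apply, smul_eq_mul]
    at e₀ e₁
  rw [e₀, e₁]
  rcases n • some x y h with _ | ⟨x', y', h'⟩
  · simp [← zero_def, ha]
  · simp [mul_comm c, ha]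

omit [IsAlgClosed F] [CharZero F] in
lemma nsmul_some_eq_or_eq_neg_iff {x y x' y' : F} (h : W.toAffine.Nonsingular x y)
    (h' : W.toAffine.Nonsingular x' y') (n : ℕ) :
    (n • some x y h = some x' y' h' ∨ n • some x y h = -some x' y' h') ↔
      (W.xMul n).1.eval x = x' * (W.xMul n).2.eval x := by
  rw [← xRep_nsmul_some_eq_iff h n x', ← xRep_some h', xRep_eq_xRep_iff]

/-- Over an algebraically closed field each `x` lifts to a point, and `(p(x), q(x))` is a nonzero
multiple of the coordinates of its `n`-th multiple. -/
lemma eval_xMul_ne_zero (x : F) (n : ℕ) (h : (W.xMul n).2.eval x = 0) :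
    (W.xMul n).1.eval x ≠ 0 := by
  obtain ⟨y, hy⟩ := W.exists_point x
  obtain ⟨c, hc, e⟩ := exists_evalPair_xMul hy n
  intro h'
  apply smul_ne_zero hc (xRep_ne_zero (n • some x y hy))
  rw [← e]
  ext i
  fin_cases i <;> simp [evalPair, h, h']

omit [DecidableEq F] [IsAlgClosed F] [CharZero F] [W.IsElliptic] in
variable (W) in
lemma hasTop_xMul_sub {n : ℕ} (hn : n ≠ 0) (c : F) :
    HasTop (n ^ 2) 1 ((W.xMul n).1 - C c * (W.xMul n).2) := by
  have h := ((HasTop.C c).mul (W.hasTop_xMul_snd n)).raise (e := n ^ 2)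
    (by have := Nat.pos_of_ne_zero (pow_ne_zero 2 hn); lia)
  exact ((W.hasTop_xMul_fst n).sub h).congr rfl (by ring)

omit [DecidableEq F] [IsAlgClosed F] [CharZero F] [W.IsElliptic] in
variable (W) in
lemma natDegree_xMul_sub {n : ℕ} (hn : n ≠ 0) (c : F) :
    ((W.xMul n).1 - C c * (W.xMul n).2).natDegree = n ^ 2 :=
  le_antisymm (W.hasTop_xMul_sub hn c).1
    (le_natDegree_of_ne_zero (by rw [(W.hasTop_xMul_sub hn c).2]; exact one_ne_zero))

/-- Multiplication by `n ≠ 0` is surjective. -/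
theorem nsmul_surjective {n : ℕ} (hn : n ≠ 0) :
    Function.Surjective (fun P : W.toAffine.Point => n • P) := by
  rintro (_ | ⟨c, d, hc⟩)
  · exact ⟨0, smul_zero n⟩
  -- A root of `p - c q`, of degree `n²`, is the `x`-coordinate of a point whose multiple is the
  -- target up to sign; the sign is then corrected.
  · obtain ⟨x, hx⟩ := IsAlgClosed.exists_root ((W.xMul n).1 - C c * (W.xMul n).2) (by
      intro h
      have := natDegree_eq_of_degree_eq_some h
      rw [W.natDegree_xMul_sub hn] at this
      exact pow_ne_zero 2 hn this)
    obtain ⟨y, hy⟩ := W.exists_point x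
    rcases (nsmul_some_eq_or_eq_neg_iff hy hc n).2 (by simpa [sub_eq_zero] using hx) with h | h
    · exact ⟨_, h⟩
    · exact ⟨-some x y hy, by simp only [smul_neg, h, neg_neg]⟩

-- This is the separability of multiplication by `n`. With top coefficients `1` in degree `d + 1`
-- and `n²` in degree `d`, the top coefficient of the Wronskian is `(d + 1) n² - d n² = n²`, nonzero
-- in characteristic zero. The factor `X` before each derivative keeps the degrees unshifted.
omit [DecidableEq F] [IsAlgClosed F] [W.IsElliptic] in
variable (W) in
lemma wronskian_xMul_ne_zero {n : ℕ} (hn : n ≠ 0) :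
    derivative (W.xMul n).1 * (W.xMul n).2 - (W.xMul n).1 * derivative (W.xMul n).2 ≠ 0 := by
  have top {d : ℕ} {c : F} {f : F[X]} (h : HasTop d c f) : HasTop d (d * c) (X * derivative f) := by
    rcases d with _ | d
    · rw [eq_C_of_natDegree_le_zero h.1]
      simp [HasTop]
    · refine (HasTop.X.mul (e := d) ⟨(natDegree_derivative_le f).trans
        (Nat.sub_le_of_le_add h.1), rfl⟩).congr (by ring) ?_
      rw [coeff_derivative, h.2]
      push_cast
      ring
  obtain ⟨d, hd, h₁, h₂⟩ := W.hasTop_xMul_succ n hn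
  have h := (((top h₁).mul h₂).sub ((h₁.mul (top h₂)))).2
  intro hw
  have : X * derivative (W.xMul n).1 * (W.xMul n).2 -
      (W.xMul n).1 * (X * derivative (W.xMul n).2) = 0 := by
    rw [← mul_zero X, ← hw]
    ring
  rw [this, coeff_zero] at h
  have hn' : (n : F) ≠ 0 := Nat.cast_ne_zero.2 hn
  apply pow_ne_zero 2 hn'
  push_cast at h
  linear_combination -h

/-- For all but finitely many `c`, the equation `x(n • P) = c` has `n ^ 2` solutions `x(P)`. -/
lemma exists_card_roots_xMul_sub {n : ℕ} (hn : n ≠ 0) (s : Set F) (hs : s.Finite) :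
    ∃ c ∉ s, ((W.xMul n).1 - C c * (W.xMul n).2).roots.toFinset.card = n ^ 2 := by
  set p := (W.xMul n).1 with hp
  set q := (W.xMul n).2 with hq
  set w := derivative p * q - p * derivative q with hw
  -- The critical values `p(a) / q(a)`, with `a` a zero of the Wronskian, are avoided: a multiple
  -- root `a` of `p - c q` satisfies `p = c q` and `p' = c q'` there, so it is such a zero.
  obtain ⟨c, hc⟩ := ((w.roots.toFinset.image fun a => p.eval a / q.eval a).finite_toSet.union
    hs).exists_notMem
  simp only [Finset.coe_image, Set.mem_union, Set.mem_image, not_or, not_exists] at hc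
  refine ⟨c, hc.2, ?_⟩
  have hf : p - C c * q ≠ 0 := by
    intro h
    have := W.natDegree_xMul_sub hn c
    rw [← hp, ← hq, h, natDegree_zero] at this
    exact pow_ne_zero 2 hn this.symm
  rw [Multiset.toFinset_card_of_nodup, IsAlgClosed.card_roots_eq_natDegree, hp, hq,
    W.natDegree_xMul_sub hn]
  rw [Multiset.nodup_iff_count_le_one]
  intro a
  rw [count_roots]
  by_contra! hlt
  obtain ⟨h₁, h₂⟩ := (one_lt_rootMultiplicity_iff_isRoot hf).1 hlt
  simp only [IsRoot, eval_sub, eval_mul, eval_C, derivative_sub, derivative_mul, derivative_C,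
    zero_mul, zero_add, sub_eq_zero] at h₁ h₂
  have hqa : q.eval a ≠ 0 := fun h => eval_xMul_ne_zero a n h (by
    rw [← hp, h₁, h, mul_zero])
  apply hc.1 a
  refine ⟨?_, by rw [h₁, mul_div_cancel_right₀ _ hqa]⟩
  rw [Finset.mem_coe, Multiset.mem_toFinset, mem_roots (W.wronskian_xMul_ne_zero hn)]
  simp only [IsRoot, eval_sub, eval_mul, ← hp, ← hq, h₁, h₂]
  ring

variable (W)

/-- An elliptic curve over an algebraically closed field of characteristic zero has `n ^ 2` points
of order dividing `n`. -/
theorem ncard_torsion {n : ℕ} (hn : n ≠ 0) :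
    {P : W.toAffine.Point | n • P = 0}.ncard = n ^ 2 := by
  -- The value `c` is also taken off the two-torsion. Then `Q ≠ -Q` for `Q` over `c`, so exactly one
  -- of the two points over each root has multiple `Q`, and the fibre over `Q` has `n²` points.
  obtain ⟨c, hc, hcard⟩ := exists_card_roots_xMul_sub (W := W) hn
    {c | (W.xMul 2).2.eval c = 0} (by
      have h : (W.xMul 2).2 ≠ 0 := fun h => by
        have := (W.hasTop_xMul_snd 2).2
        norm_num [h] at this
      exact ((W.xMul 2).2.rootSet_finite F).subset fun c hc => by
        simpa [mem_rootSet, h] using hc)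
  obtain ⟨d, hd⟩ := W.exists_point c
  have hQ : some c d hd ≠ -some c d hd := by
    intro h
    apply hc
    rw [Set.mem_ofPred_eq, ← nsmul_some_eq_zero_iff hd, two_nsmul]
    exact eq_neg_iff_add_eq_zero.1 h
  obtain ⟨P₀, hP₀ : n • P₀ = some c d hd⟩ := nsmul_surjective hn (some c d hd)
  have hshift : {P : W.toAffine.Point | n • P = some c d hd}.ncard = n ^ 2 := by
    rw [← hcard, ← Set.ncard_coe_finset]
    refine Set.ncard_congr (fun P _ => P.xRep 0) ?_ ?_ ?_
    · rintro (_ | ⟨x, y, h⟩) hP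
      · rw [← zero_def, Set.mem_ofPred_eq, smul_zero] at hP
        exact absurd hP.symm (some_ne_zero _)
      · have hne : (W.xMul n).1 - C c * (W.xMul n).2 ≠ 0 := fun h => by
          have := W.natDegree_xMul_sub hn c
          rw [h, natDegree_zero] at this
          exact pow_ne_zero 2 hn this.symm
        simpa [mem_roots hne, sub_eq_zero] using
          (nsmul_some_eq_or_eq_neg_iff h hd n).1 (Or.inl hP)
    · intro P P' hP hP' he
      simp only [Set.mem_ofPred_eq] at hP hP'
      have hx : P.xRep = P'.xRep := by
        rcases P with _ | ⟨x, y, h⟩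
        · rw [← zero_def, smul_zero] at hP
          exact absurd hP.symm (some_ne_zero _)
        · rcases P' with _ | ⟨x', y', h'⟩
          · rw [← zero_def, smul_zero] at hP'
            exact absurd hP'.symm (some_ne_zero _)
          · simpa using he
      rcases xRep_eq_xRep_iff.1 hx with h | h
      · exact h
      · rw [h, smul_neg, hP'] at hP
        exact absurd hP.symm hQ
    · intro x hx
      obtain ⟨y, hy⟩ := W.exists_point x
      rw [Finset.mem_coe, Multiset.mem_toFinset] at hx
      rcases (nsmul_some_eq_or_eq_neg_iff hy hd n).2
        (by simpa [sub_eq_zero] using isRoot_of_mem_roots hx) with h | h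
      · exact ⟨some x y hy, h, by simp⟩
      · exact ⟨-some x y hy, by simp only [Set.mem_ofPred_eq, smul_neg, h, neg_neg], by simp⟩
  -- All fibres of a surjective homomorphism have the same size: translation by `P₀` carries the
  -- kernel to the fibre over `Q`.
  rw [← hshift]
  refine Set.ncard_congr (fun P _ => P + P₀) ?_ ?_ ?_
  · intro P hP
    simp only [Set.mem_ofPred_eq] at hP ⊢
    rw [smul_add, hP, zero_add, hP₀]
  · intro P P' _ _ h
    simpa using h
  · intro P hP
    simp only [Set.mem_ofPred_eq] at hP
    exact ⟨P - P₀, by simp [smul_sub, hP, hP₀], by simp⟩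

lemma finite_torsion {n : ℕ} (hn : n ≠ 0) : {P : W.toAffine.Point | n • P = 0}.Finite :=
  Set.finite_of_ncard_ne_zero (by rw [W.ncard_torsion hn]; exact pow_ne_zero 2 hn)

/-- No isomorphism of `E[n]` with `(ℤ/n)²` is needed: the numbers `d²` of `d`-torsion elements, for
`d ∣ n`, determine the number of elements of order `n`. -/
lemma ncard_addOrderOf {n : ℕ} (hn : n ≠ 0) :
    {P : W.toAffine.Point | addOrderOf P = n}.ncard = ConfCP1.numPrimitive n := by
  have : NeZero n := ⟨hn⟩
  have hd {d : ℕ} (h : d ∣ n) : d ≠ 0 := fun h' => hn (by simpa [h'] using h)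
  exact ncard_addOrderOf_eq_of_ncard_torsion_eq hn (fun d h => W.finite_torsion (hd h))
    (fun _ _ => Set.toFinite _)
    fun d h => by rw [W.ncard_torsion (hd h), ZMod.ncard_torsion_prod h]

end WeierstrassCurve

/-! ### Monic polynomials with prescribed simple roots. -/

namespace Polynomial

variable {F : Type*} [Field F]

/-- `f` is monic with simple roots, and splits with set of roots `s`. -/
def IsProdOver (f : F[X]) (s : Set F) : Prop :=
  ∃ t : Finset F, (t : Set F) = s ∧ f = ∏ x ∈ t, (X - C x)

namespace IsProdOver

variable {f g : F[X]} {s t : Set F}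

lemma monic (h : IsProdOver f s) : f.Monic := by
  obtain ⟨t, -, rfl⟩ := h
  exact monic_prod_of_monic _ _ fun x _ => monic_X_sub_C x

lemma natDegree_eq (h : IsProdOver f s) : f.natDegree = s.ncard := by
  obtain ⟨t, rfl, rfl⟩ := h
  rw [natDegree_prod_of_monic _ _ fun x _ => monic_X_sub_C x, Set.ncard_coe_finset]
  simp

lemma eval_eq_zero_iff (h : IsProdOver f s) {x : F} : f.eval x = 0 ↔ x ∈ s := by
  obtain ⟨t, rfl, rfl⟩ := h
  simp [eval_prod, Finset.prod_eq_zero_iff, sub_eq_zero]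

lemma of_natDegree_le (hf : f.Monic) (hs : s.Finite) (hd : f.natDegree ≤ s.ncard)
    (h : ∀ x ∈ s, f.eval x = 0) : IsProdOver f s := by
  refine ⟨hs.toFinset, hs.coe_toFinset, ?_⟩
  refine eq_of_monic_of_dvd_of_natDegree_le (monic_prod_of_monic _ _ fun x _ => monic_X_sub_C x)
    hf ?_ ?_
  · have : hs.toFinset.val ≤ f.roots := by
      rw [Multiset.le_iff_subset hs.toFinset.nodup]
      intro x hx
      rw [mem_roots hf.ne_zero]
      exact h x (by simpa using hx)
    exact (Multiset.prod_X_sub_C_dvd_iff_le_roots hf.ne_zero _).2 this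
  · rw [natDegree_prod_of_monic _ _ fun x _ => monic_X_sub_C x]
    simpa [← Set.ncard_eq_toFinset_card s hs] using hd

lemma prod {ι : Type*} (I : Finset ι) {f : ι → F[X]} {s : ι → Set F}
    (h : ∀ i ∈ I, IsProdOver (f i) (s i)) (hs : (I : Set ι).PairwiseDisjoint s) :
    IsProdOver (∏ i ∈ I, f i) (⋃ i ∈ I, s i) := by
  classical
  choose! t ht hf using h
  refine ⟨I.biUnion t, ?_, ?_⟩
  · rw [Finset.coe_biUnion]
    exact Set.iUnion₂_congr fun i hi => ht i hi
  · rw [Finset.prod_biUnion, Finset.prod_congr rfl hf]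
    intro i hi j hj hij
    rw [Function.onFun, ← Finset.disjoint_coe, ht i hi, ht j hj]
    exact hs hi hj hij

lemma divByMonic (hf : IsProdOver f s) (hg : IsProdOver g t) (h : t ⊆ s) :
    IsProdOver (f /ₘ g) (s \ t) := by
  classical
  have hm := hg.monic
  obtain ⟨s, rfl, rfl⟩ := hf
  obtain ⟨t, rfl, rfl⟩ := hg
  refine ⟨s \ t, by simp, ?_⟩
  rw [← Finset.prod_sdiff (Finset.coe_subset.1 h), mul_comm, mul_divByMonic_cancel_left _ hm]

end IsProdOver

end Polynomial

/-! ### Primitive division polynomials. -/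

namespace WeierstrassCurve

open Polynomial WeierstrassCurve.Affine WeierstrassCurve.Affine.Point

section TorsionPolynomial

variable {R : Type*} [CommRing R] (W : WeierstrassCurve R)

/-- A polynomial whose zeros are the `x`-coordinates of the nonzero points of order dividing `n`:
with `n = a + b` and `a - b ∈ {1, 2}`, it expresses that `a • P` and `b • P` have the same
`x`-coordinate. -/
noncomputable def torsionPolynomial (n : ℕ) : R[X] :=
  let b := (n - 1) / 2
  let a := n - b
  (W.xMul a).1 * (W.xMul b).2 - (W.xMul b).1 * (W.xMul a).2

lemma map_torsionPolynomial {S : Type*} [CommRing S] (f : R →+* S) (n : ℕ) :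
    (W.map f).torsionPolynomial n = (W.torsionPolynomial n).map f := by
  simp [torsionPolynomial, map_xMul]

/-- Both products have formal top degree `a² + b² - 1`, with coefficients `b²` and `a²`; in
characteristic zero these do not cancel. -/
lemma hasTop_xMul_sub_xMul {a b : ℕ} (hab : b < a) : HasTop (a ^ 2 + b ^ 2 - 1)
    ((b : R) ^ 2 - (a : R) ^ 2) ((W.xMul a).1 * (W.xMul b).2 - (W.xMul b).1 * (W.xMul a).2) := by
  have ha : 0 < a ^ 2 := pow_pos (by lia) 2
  refine HasTop.sub ?_ (((W.hasTop_xMul_fst b).mul (W.hasTop_xMul_snd a)).congr (by lia) (by ring))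
  rcases Nat.eq_zero_or_pos b with rfl | hb
  -- For `b = 0` the bound `b ^ 2 - 1` is truncated, but the product is zero.
  · simp [HasTop]
  · have := pow_pos hb 2
    exact ((W.hasTop_xMul_fst a).mul (W.hasTop_xMul_snd b)).congr (by lia) (by ring)

end TorsionPolynomial

variable {F : Type*} [Field F] [DecidableEq F]

/-- The `x`-coordinates of the points of order `d`. -/
def xOfOrder (W : WeierstrassCurve F) (d : ℕ) : Set F :=
  {x | ∃ y, ∃ h : W.toAffine.Nonsingular x y, addOrderOf (some x y h) = d}

lemma mem_xOfOrder_iff {W : WeierstrassCurve F} {x y : F} (h : W.toAffine.Nonsingular x y)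
    {d : ℕ} : x ∈ W.xOfOrder d ↔ addOrderOf (some x y h) = d := by
  refine ⟨?_, fun hd => ⟨y, h, hd⟩⟩
  rintro ⟨y', h', rfl⟩
  rcases (X_eq_iff (h₁ := h) (h₂ := h')).1 rfl with e | e <;>
    simp only [e, addOrderOf_neg]

lemma disjoint_xOfOrder (W : WeierstrassCurve F) {d e : ℕ} (h : d ≠ e) :
    Disjoint (W.xOfOrder d) (W.xOfOrder e) := by
  rw [Set.disjoint_left]
  rintro x ⟨y, hy, rfl⟩ hx
  exact h ((mem_xOfOrder_iff hy).1 hx)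

/-- Away from the points of order two, the `x`-coordinate is two-to-one. -/
lemma ncard_eq_two_mul_ncard_image {W : WeierstrassCurve F} {β : Type*} (f : W.toAffine.Point → β)
    (hf : ∀ P Q, f P = f Q ↔ P = Q ∨ P = -Q) {T : Set W.toAffine.Point} (hT : T.Finite)
    (hneg : ∀ P ∈ T, -P ∈ T) (h2 : ∀ P ∈ T, 2 • P ≠ 0) : T.ncard = 2 * (f '' T).ncard := by
  classical
  lift T to Finset W.toAffine.Point using hT
  rw [Set.ncard_coe_finset, ← Finset.coe_image, Set.ncard_coe_finset,
    Finset.card_eq_sum_card_image f T, Finset.sum_const_nat (m := 2) _, mul_comm]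
  intro z hz
  obtain ⟨P, hP, rfl⟩ := Finset.mem_image.1 hz
  have : T.filter (fun Q => f Q = f P) = {P, -P} := by
    ext Q
    simp only [Finset.mem_filter, Finset.mem_insert, Finset.mem_singleton, hf]
    refine and_iff_right_of_imp ?_
    rintro (rfl | rfl)
    exacts [hP, hneg P hP]
  rw [this, Finset.card_pair]
  intro h
  exact h2 P hP (by rw [two_nsmul]; exact eq_neg_iff_add_eq_zero.1 h)

lemma ncard_addOrderOf_eq_two_mul (W : WeierstrassCurve F) {d : ℕ} (hd : 3 ≤ d)
    (hfin : {P : W.toAffine.Point | addOrderOf P = d}.Finite) :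
    {P : W.toAffine.Point | addOrderOf P = d}.ncard = 2 * (W.xOfOrder d).ncard := by
  rw [ncard_eq_two_mul_ncard_image (fun P => P.xRep) (fun _ _ => xRep_eq_xRep_iff) hfin]
  · congr 1
    symm
    refine Set.ncard_congr (fun x _ => ![x, 1]) ?_ ?_ ?_
    · rintro x ⟨y, h, hd⟩
      exact ⟨_, hd, by simp⟩
    · intro x x' _ _ h
      simpa using congrFun h 0
    · rintro _ ⟨P, hP, rfl⟩
      rcases P with _ | ⟨x, y, h⟩
      · rw [← zero_def, Set.mem_ofPred_eq, addOrderOf_zero] at hP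
        lia
      · exact ⟨x, ⟨y, h, hP⟩, by simp⟩
  · intro P hP
    simpa using hP
  · intro P hP h
    rw [Set.mem_ofPred_eq] at hP
    have := Nat.le_of_dvd two_pos (hP ▸ addOrderOf_dvd_of_nsmul_eq_zero h)
    lia

lemma ncard_addOrderOf_two (W : WeierstrassCurve F) :
    {P : W.toAffine.Point | addOrderOf P = 2}.ncard = (W.xOfOrder 2).ncard := by
  refine Set.ncard_congr (fun P _ => P.xRep 0) ?_ ?_ ?_
  · rintro (_ | ⟨x, y, h⟩) hP
    · rw [← zero_def, Set.mem_ofPred_eq, addOrderOf_zero] at hP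
      lia
    · exact ⟨y, h, hP⟩
  · rintro (_ | ⟨x, y, h⟩) (_ | ⟨x', y', h'⟩) hP hP' he
    · rfl
    · rw [← zero_def, Set.mem_ofPred_eq, addOrderOf_zero] at hP
      lia
    · rw [← zero_def, Set.mem_ofPred_eq, addOrderOf_zero] at hP'
      lia
    · rw [Set.mem_ofPred_eq] at hP'
      have hneg : -some x' y' h' = some x' y' h' := by
        rw [neg_eq_iff_add_eq_zero, ← two_nsmul, ← hP', addOrderOf_nsmul_eq_zero]
      rcases (X_eq_iff (h₁ := h) (h₂ := h')).1 (by simpa using he) with e | e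
      · exact e
      · exact e.trans hneg
  · rintro x ⟨y, h, hd⟩
    exact ⟨_, hd, by simp⟩

variable [IsAlgClosed F] [CharZero F] (W : WeierstrassCurve F) [W.IsElliptic]

lemma finite_addOrderOf {d : ℕ} (hd : d ≠ 0) : {P : W.toAffine.Point | addOrderOf P = d}.Finite :=
  (W.finite_torsion hd).subset fun P hP => by
    rw [Set.mem_ofPred_eq] at hP ⊢
    rw [← hP, addOrderOf_nsmul_eq_zero]

lemma finite_xOfOrder {d : ℕ} (hd : d ≠ 0) : (W.xOfOrder d).Finite :=
  ((W.finite_addOrderOf hd).image fun P => P.xRep 0).subset fun x hx => by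
    obtain ⟨y, h, hd⟩ := hx
    exact ⟨_, hd, by simp⟩

lemma ncard_iUnion_xOfOrder (I : Finset ℕ) (hI : 0 ∉ I) :
    (⋃ d ∈ I, W.xOfOrder d).ncard = ∑ d ∈ I, (W.xOfOrder d).ncard := by
  induction I using Finset.induction_on with
  | empty => simp
  | insert d I hd ih =>
    have h0 : 0 ∉ I := fun h => hI (Finset.mem_insert_of_mem h)
    have hd0 : d ≠ 0 := fun h => hI (h ▸ Finset.mem_insert_self _ _)
    rw [Finset.set_biUnion_insert, Finset.sum_insert hd, Set.ncard_union_eq ?_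
      (W.finite_xOfOrder hd0) ?_, ih h0]
    · rw [Set.disjoint_iUnion₂_right]
      exact fun e he => W.disjoint_xOfOrder fun h => hd (h ▸ he)
    · exact I.finite_toSet.biUnion fun e he => W.finite_xOfOrder fun h => h0 (h ▸ he)

omit [IsAlgClosed F] [CharZero F] [W.IsElliptic] in
lemma ncard_addOrderOf_one : {P : W.toAffine.Point | addOrderOf P = 1}.ncard = 1 := by
  simp [AddMonoid.addOrderOf_eq_one_iff]

lemma ncard_addOrderOf_two_eq_three : {P : W.toAffine.Point | addOrderOf P = 2}.ncard = 3 := by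
  have := ncard_torsion_eq_sum_ncard_addOrderOf two_ne_zero (W.finite_torsion two_ne_zero)
  rw [ncard_torsion _ two_ne_zero, Nat.Prime.divisors Nat.prime_two,
    Finset.sum_pair (by simp), ncard_addOrderOf_one] at this
  lia

/-- The `x`-coordinate is two-to-one on the nonzero `n`-torsion, except at the three points of order
two, present when `n` is even. The count is `(n² - 1) / 2` for odd `n` and `(n² - 4) / 2 + 3` for
even `n`, which is the degree of `torsionPolynomial` in both cases. -/
lemma ncard_iUnion_xOfOrder_divisors {n : ℕ} (hn : 2 ≤ n) :
    (⋃ d ∈ n.divisors.erase 1, W.xOfOrder d).ncard =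
      (n - (n - 1) / 2) ^ 2 + ((n - 1) / 2) ^ 2 - 1 := by
  have hn0 : n ≠ 0 := by lia
  rw [ncard_iUnion_xOfOrder _ _ (by simp)]
  have hsum := ncard_torsion_eq_sum_ncard_addOrderOf hn0 (W.finite_torsion hn0)
  rw [ncard_torsion _ hn0, ← Finset.add_sum_erase _ _ (Nat.one_mem_divisors.2 hn0)] at hsum
  have h3 (I : Finset ℕ) (hI : ∀ d ∈ I, 3 ≤ d) :
      ∑ d ∈ I, {P : W.toAffine.Point | addOrderOf P = d}.ncard =
        2 * ∑ d ∈ I, (W.xOfOrder d).ncard := by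
    rw [Finset.mul_sum]
    exact Finset.sum_congr rfl fun d hd => W.ncard_addOrderOf_eq_two_mul (hI d hd)
      (W.finite_addOrderOf (by have := hI d hd; lia))
  have hge (d : ℕ) (hd : d ∈ n.divisors.erase 1) : 2 ≤ d := by
    have := Nat.pos_of_mem_divisors (Finset.mem_of_mem_erase hd)
    have := Finset.ne_of_mem_erase hd
    lia
  rw [ncard_addOrderOf_one] at hsum
  obtain ⟨k, rfl | rfl⟩ := Nat.even_or_odd' n
  · have h2 : 2 ∈ (2 * k).divisors.erase 1 := by simp [show k ≠ 0 by lia]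
    have hge' (d : ℕ) (hd : d ∈ ((2 * k).divisors.erase 1).erase 2) : 3 ≤ d := by
      have := hge d (Finset.mem_of_mem_erase hd)
      have := Finset.ne_of_mem_erase hd
      lia
    rw [← Finset.add_sum_erase _ _ h2, h3 _ hge', ncard_addOrderOf_two_eq_three] at hsum
    rw [← Finset.add_sum_erase _ _ h2, ← ncard_addOrderOf_two, ncard_addOrderOf_two_eq_three]
    obtain ⟨k, rfl⟩ : ∃ j, k = j + 1 := ⟨k - 1, by lia⟩
    rw [show (2 * (k + 1) - 1) / 2 = k by lia, show 2 * (k + 1) - k = k + 2 by lia]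
    ring_nf at hsum ⊢
    lia
  · have hge' (d : ℕ) (hd : d ∈ (2 * k + 1).divisors.erase 1) : 3 ≤ d := by
      have := hge d hd
      have : d ≠ 2 := by
        rintro rfl
        have := Nat.dvd_of_mem_divisors (Finset.mem_of_mem_erase hd)
        lia
      lia
    rw [h3 _ hge'] at hsum
    rw [show (2 * k + 1 - 1) / 2 = k by lia, show 2 * k + 1 - k = k + 1 by lia]
    ring_nf at hsum ⊢
    lia

omit [IsAlgClosed F] [CharZero F] in
lemma eval_torsionPolynomial_eq_zero {n : ℕ} {x y : F} (h : W.toAffine.Nonsingular x y)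
    (hx : n • some x y h = 0) : (W.torsionPolynomial n).eval x = 0 := by
  obtain ⟨c, hc, e⟩ := exists_evalPair_xMul h (n - (n - 1) / 2)
  obtain ⟨c', hc', e'⟩ := exists_evalPair_xMul h ((n - 1) / 2)
  have heq : (n - (n - 1) / 2) • some x y h = -(((n - 1) / 2) • some x y h) := by
    rw [eq_neg_iff_add_eq_zero, ← add_smul, Nat.sub_add_cancel (by lia), hx]
  rw [heq, xRep_neg] at e
  have e₀ := congrFun e 0
  have e₁ := congrFun e 1
  have e₀' := congrFun e' 0
  have e₁' := congrFun e' 1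
  simp only [evalPair, Matrix.cons_val_one, Matrix.cons_val_zero, Pi.smul_apply, smul_eq_mul]
    at e₀ e₁ e₀' e₁'
  simp only [torsionPolynomial, eval_sub, eval_mul, e₀, e₁, e₀', e₁']
  ring

omit [DecidableEq F] [IsAlgClosed F] in
lemma sub_sq_ne_zero {n : ℕ} (hn : 2 ≤ n) :
    (((n - 1) / 2 : ℕ) : F) ^ 2 - ((n - (n - 1) / 2 : ℕ) : F) ^ 2 ≠ 0 := by
  rw [sub_ne_zero]
  norm_cast
  exact (Nat.pow_lt_pow_left (by lia) two_ne_zero).ne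

/-- The normalized polynomial vanishes at every nonzero `n`-torsion abscissa, and its degree is the
number of these; so there are no other zeros and all are simple. -/
lemma isProdOver_torsionPolynomial {n : ℕ} (hn : 2 ≤ n) :
    IsProdOver (C ((((n - 1) / 2 : ℕ) : F) ^ 2 - ((n - (n - 1) / 2 : ℕ) : F) ^ 2)⁻¹ *
      W.torsionPolynomial n) (⋃ d ∈ n.divisors.erase 1, W.xOfOrder d) := by
  have htop := (HasTop.C ((((n - 1) / 2 : ℕ) : F) ^ 2 - ((n - (n - 1) / 2 : ℕ) : F) ^ 2)⁻¹).mul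
    (W.hasTop_xMul_sub_xMul (a := n - (n - 1) / 2) (b := (n - 1) / 2) (by lia))
  rw [inv_mul_cancel₀ (sub_sq_ne_zero hn), zero_add] at htop
  refine IsProdOver.of_natDegree_le (monic_of_natDegree_le_of_coeff_eq_one _ htop.1 htop.2) ?_ ?_ ?_
  · exact (Finset.finite_toSet _).biUnion fun d hd => W.finite_xOfOrder
      (Nat.pos_of_mem_divisors (Finset.mem_of_mem_erase hd)).ne'
  · rw [ncard_iUnion_xOfOrder_divisors _ hn]
    exact htop.1
  · simp only [Set.mem_iUnion, exists_prop, forall_exists_index, and_imp]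
    rintro x d hd ⟨y, h, rfl⟩
    rw [eval_mul, eval_torsionPolynomial_eq_zero _ h, mul_zero]
    exact addOrderOf_dvd_iff_nsmul_eq_zero.1 (Nat.dvd_of_mem_divisors (Finset.mem_of_mem_erase hd))

/-- Primitive division polynomials: the monic polynomial whose zeros are the `x`-coordinates of the
points of order `n` depends polynomially on the coefficients of the curve. -/
theorem exists_primitiveDivisionPolynomial {R : Type*} [CommRing R] [Nontrivial R] [Algebra F R]
    (W : WeierstrassCurve R) {n : ℕ} (hn : 2 ≤ n) :
    ∃ L : R[X], L.Monic ∧ ∀ φ : R →ₐ[F] F, (W.map (φ : R →+* F)).IsElliptic →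
      IsProdOver (L.map (φ : R →+* F)) ((W.map (φ : R →+* F)).xOfOrder n) := by
  induction n using Nat.strong_induction_on with
  | _ n ih =>
    have hn0 : n ≠ 0 := by lia
    set I := n.properDivisors.erase 1 with hI
    have hI2 (d : ℕ) (hd : d ∈ I) : 2 ≤ d := by
      have := Nat.pos_of_mem_properDivisors (Finset.mem_of_mem_erase hd)
      have := Finset.ne_of_mem_erase hd
      lia
    choose! L hLm hL using fun d (hd : d ∈ I) =>
      ih d (Nat.mem_properDivisors.1 (Finset.mem_of_mem_erase hd)).2 (hI2 d hd)
    set u : F := ((((n - 1) / 2 : ℕ) : F) ^ 2 - ((n - (n - 1) / 2 : ℕ) : F) ^ 2)⁻¹ with hu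
    set E : R[X] := C (algebraMap F R u) * W.torsionPolynomial n with hE
    set Q : R[X] := ∏ d ∈ I, L d with hQ
    have hQm : Q.Monic := monic_prod_of_monic _ _ hLm
    have hEm : E.Monic := by
      have htop := (HasTop.C (algebraMap F R u)).mul
        (W.hasTop_xMul_sub_xMul (a := n - (n - 1) / 2) (b := (n - 1) / 2) (by lia))
      refine monic_of_natDegree_le_of_coeff_eq_one _ htop.1 (htop.2.trans ?_)
      rw [← map_natCast (algebraMap F R), ← map_natCast (algebraMap F R), ← map_pow, ← map_pow,
        ← map_sub, ← map_mul, hu, inv_mul_cancel₀ (sub_sq_ne_zero hn), map_one]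
    have hEφ (φ : R →ₐ[F] F) (hφ : (W.map (φ : R →+* F)).IsElliptic) :
        IsProdOver (E.map (φ : R →+* F))
          (⋃ d ∈ n.divisors.erase 1, (W.map (φ : R →+* F)).xOfOrder d) := by
      have := (W.map (φ : R →+* F)).isProdOver_torsionPolynomial hn
      rw [map_torsionPolynomial] at this
      simpa [hE, hu] using this
    have hQφ (φ : R →ₐ[F] F) (hφ : (W.map (φ : R →+* F)).IsElliptic) :
        IsProdOver (Q.map (φ : R →+* F)) (⋃ d ∈ I, (W.map (φ : R →+* F)).xOfOrder d) := by
      rw [hQ, Polynomial.map_prod]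
      exact IsProdOver.prod I (fun d hd => hL d hd φ hφ)
        fun d _ e _ h => (W.map (φ : R →+* F)).disjoint_xOfOrder h
    have hins : n.divisors.erase 1 = insert n I := by
      rw [hI, ← Nat.insert_self_properDivisors hn0, Finset.erase_insert_of_ne (by lia)]
    -- Division with remainder by a monic polynomial commutes with ring maps, so exact divisibility
    -- is needed only after specialization. The degree inequality makes the quotient monic. If it
    -- fails, no specialization is elliptic, since the degrees would count a set and a subset of it;
    -- then any monic polynomial will do.
    by_cases hdeg : Q.natDegree ≤ E.natDegree
    · refine ⟨E /ₘ Q, ?_, fun φ hφ => ?_⟩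
      · rw [Monic, leadingCoeff_divByMonic_of_monic hQm, hEm.leadingCoeff]
        rwa [degree_eq_natDegree hQm.ne_zero, degree_eq_natDegree hEm.ne_zero, Nat.cast_le]
      · rw [map_divByMonic _ hQm]
        convert (hEφ φ hφ).divByMonic (hQφ φ hφ) _ using 1
        · rw [hins, Finset.set_biUnion_insert, Set.union_sdiff_right, eq_comm, sdiff_eq_left,
            Set.disjoint_iUnion₂_right]
          intro d hd
          exact disjoint_xOfOrder _
            (Nat.mem_properDivisors.1 (Finset.mem_of_mem_erase hd)).2.ne'
        · rw [hins, Finset.set_biUnion_insert]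
          exact Set.subset_union_right
    · refine ⟨1, monic_one, fun φ hφ => (hdeg ?_).elim⟩
      rw [← hQm.natDegree_map (φ : R →+* F), ← hEm.natDegree_map (φ : R →+* F),
        (hQφ φ hφ).natDegree_eq, (hEφ φ hφ).natDegree_eq]
      refine Set.ncard_le_ncard ?_ ?_
      · rw [hins, Finset.set_biUnion_insert]
        exact Set.subset_union_right
      · exact (Finset.finite_toSet _).biUnion fun d hd => finite_xOfOrder _
          (Nat.pos_of_mem_divisors (Finset.mem_of_mem_erase hd)).ne'

end WeierstrassCurve

/-! ### Invariants and covariants of binary quartic forms. -/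

namespace BinaryQuartic

section Covariants

variable {A : Type*} [CommRing A] (v : Fin 5 → A)

/-- The binary quartic form with coefficients `v`; `v i` belongs to `x ^ i * y ^ (4 - i)`. -/
def form (x y : A) : A :=
  v 4 * x ^ 4 + v 3 * x ^ 3 * y + v 2 * x ^ 2 * y ^ 2 + v 1 * x * y ^ 3 + v 0 * y ^ 4

/-- The quadratic invariant. -/
def invI : A := 12 * v 4 * v 0 - 3 * v 3 * v 1 + v 2 ^ 2

/-- The cubic invariant. -/
def invJ : A :=
  72 * v 4 * v 2 * v 0 + 9 * v 3 * v 2 * v 1 - 27 * v 4 * v 1 ^ 2 - 27 * v 0 * v 3 ^ 2 - 2 * v 2 ^ 3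

/-- The Hessian covariant. -/
def hessian (x y : A) : A :=
  (3 * v 3 ^ 2 - 8 * v 4 * v 2) * x ^ 4 + 4 * (v 3 * v 2 - 6 * v 4 * v 1) * x ^ 3 * y +
    2 * (2 * v 2 ^ 2 - 24 * v 4 * v 0 - 3 * v 3 * v 1) * x ^ 2 * y ^ 2 +
    4 * (v 2 * v 1 - 6 * v 3 * v 0) * x * y ^ 3 + (3 * v 1 ^ 2 - 8 * v 2 * v 0) * y ^ 4

/-- The sextic covariant. -/
def sextic (x y : A) : A :=
  (v 3 ^ 3 + 8 * v 4 ^ 2 * v 1 - 4 * v 4 * v 3 * v 2) * x ^ 6 +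
    2 * (16 * v 4 ^ 2 * v 0 + 2 * v 4 * v 3 * v 1 - 4 * v 4 * v 2 ^ 2 + v 3 ^ 2 * v 2) * x ^ 5 * y +
    5 * (8 * v 4 * v 3 * v 0 + v 3 ^ 2 * v 1 - 4 * v 4 * v 2 * v 1) * x ^ 4 * y ^ 2 +
    20 * (v 3 ^ 2 * v 0 - v 4 * v 1 ^ 2) * x ^ 3 * y ^ 3 -
    5 * (8 * v 4 * v 1 * v 0 + v 3 * v 1 ^ 2 - 4 * v 3 * v 2 * v 0) * x ^ 2 * y ^ 4 -
    2 * (16 * v 4 * v 0 ^ 2 + 2 * v 3 * v 1 * v 0 - 4 * v 2 ^ 2 * v 0 + v 2 * v 1 ^ 2) * x * y ^ 5 -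
    (v 1 ^ 3 + 8 * v 3 * v 0 ^ 2 - 4 * v 2 * v 1 * v 0) * y ^ 6

lemma syzygy (x y : A) : 27 * sextic v x y ^ 2 =
    hessian v x y ^ 3 - 48 * invI v * form v x y ^ 2 * hessian v x y -
      64 * invJ v * form v x y ^ 3 := by
  simp only [sextic, hessian, invI, invJ, form]
  ring

/-- The coefficients of the quartic form `form v (p * x + q * y) (r * x + s * y)`. -/
def transform (p q r s : A) : Fin 5 → A :=
  ![form v q s,
    4 * v 4 * p * q ^ 3 + v 3 * (q ^ 3 * r + 3 * p * q ^ 2 * s) +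
      v 2 * (2 * q ^ 2 * r * s + 2 * p * q * s ^ 2) + v 1 * (3 * q * r * s ^ 2 + p * s ^ 3) +
      4 * v 0 * r * s ^ 3,
    6 * v 4 * p ^ 2 * q ^ 2 + v 3 * (3 * p * q ^ 2 * r + 3 * p ^ 2 * q * s) +
      v 2 * (q ^ 2 * r ^ 2 + 4 * p * q * r * s + p ^ 2 * s ^ 2) +
      v 1 * (3 * q * r ^ 2 * s + 3 * p * r * s ^ 2) + 6 * v 0 * r ^ 2 * s ^ 2,
    4 * v 4 * p ^ 3 * q + v 3 * (3 * p ^ 2 * q * r + p ^ 3 * s) +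
      v 2 * (2 * p * q * r ^ 2 + 2 * p ^ 2 * r * s) + v 1 * (q * r ^ 3 + 3 * p * r ^ 2 * s) +
      4 * v 0 * r ^ 3 * s,
    form v p r]

variable (p q r s : A)

lemma form_transform (x y : A) :
    form (transform v p q r s) x y = form v (p * x + q * y) (r * x + s * y) := by
  simp [transform, form]
  ring

lemma invI_transform : invI (transform v p q r s) = (p * s - q * r) ^ 4 * invI v := by
  simp [transform, invI, form]
  ring

set_option maxHeartbeats 1000000 in
lemma invJ_transform : invJ (transform v p q r s) = (p * s - q * r) ^ 6 * invJ v := by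
  simp [transform, invJ, form]
  ring

set_option maxHeartbeats 1000000 in
lemma hessian_transform (x y : A) : hessian (transform v p q r s) x y =
    (p * s - q * r) ^ 2 * hessian v (p * x + q * y) (r * x + s * y) := by
  simp [transform, hessian, form]
  ring

variable {B : Type*} [CommRing B] (φ : A →+* B)

lemma map_form (x y : A) : φ (form v x y) = form (φ ∘ v) (φ x) (φ y) := by
  simp only [form, map_add, map_mul, map_pow, Function.comp]

lemma map_invI : φ (invI v) = invI (φ ∘ v) := by
  simp only [invI, map_add, map_sub, map_mul, map_pow, map_ofNat, Function.comp]

lemma map_invJ : φ (invJ v) = invJ (φ ∘ v) := by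
  simp only [invJ, map_add, map_sub, map_mul, map_pow, map_ofNat, Function.comp]

lemma map_hessian (x y : A) : φ (hessian v x y) = hessian (φ ∘ v) (φ x) (φ y) := by
  simp only [hessian, map_add, map_sub, map_mul, map_pow, map_ofNat, Function.comp]

lemma map_sextic (x y : A) : φ (sextic v x y) = sextic (φ ∘ v) (φ x) (φ y) := by
  simp only [sextic, map_add, map_sub, map_mul, map_pow, map_ofNat, Function.comp]

end Covariants

end BinaryQuartic

/-! ### Homogenization of polynomials in one variable. -/

section Homogenization

open Polynomial

variable {A B : Type*} [CommRing A] [CommRing B]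

/-- The homogenization of `L` in degree `n`, at `(a, b)`. -/
noncomputable def homEval (n : ℕ) (L : A[X]) (a b : A) : A :=
  ∑ i ∈ Finset.range (n + 1), L.coeff i * a ^ i * b ^ (n - i)

lemma map_homEval (φ : A →+* B) (n : ℕ) (L : A[X]) (a b : A) :
    φ (homEval n L a b) = homEval n (L.map φ) (φ a) (φ b) := by
  simp [homEval]

lemma homEval_zero_right {L : A[X]} (hL : L.Monic) (a : A) :
    homEval L.natDegree L a 0 = a ^ L.natDegree := by
  rw [homEval, Finset.sum_range_succ, Finset.sum_eq_zero]
  · simp [hL.leadingCoeff]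
  · intro i hi
    rw [zero_pow (Nat.sub_ne_zero_of_lt (Finset.mem_range.1 hi)), mul_zero]

lemma homEval_mul_left (n : ℕ) (L : A[X]) (hn : L.natDegree ≤ n) (a b : A) :
    homEval n L (b * a) b = b ^ n * L.eval a := by
  rw [homEval, eval_eq_sum_range' (Nat.lt_succ_of_le hn), Finset.mul_sum]
  refine Finset.sum_congr rfl fun i hi => ?_
  rw [mul_pow]
  have h : b ^ n = b ^ i * b ^ (n - i) := by
    rw [← pow_add, Nat.add_sub_cancel' (Nat.le_of_lt_succ (Finset.mem_range.1 hi))]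
  rw [h]
  ring

lemma MvPolynomial.IsHomogeneous.homEval {σ : Type*} {a b : MvPolynomial σ A} {k : ℕ}
    (ha : a.IsHomogeneous k) (hb : b.IsHomogeneous k) (n : ℕ) (L : A[X]) :
    (homEval n (L.map MvPolynomial.C) a b).IsHomogeneous (k * n) := by
  refine MvPolynomial.IsHomogeneous.sum _ _ _ fun i hi => ?_
  rw [Polynomial.coeff_map]
  have h := ((ha.pow i).C_mul (L.coeff i)).mul (hb.pow (n - i))
  rwa [← mul_add, Nat.add_sub_cancel' (Nat.le_of_lt_succ (Finset.mem_range.1 hi))] at h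

end Homogenization

namespace BinaryQuartic

section Forms

variable {A : Type*} [CommRing A] (v : Fin 5 → A)

open MvPolynomial

lemma isHomogeneous_monomial_pair (a : A) (i j : ℕ) :
    (C a * X 0 ^ i * X 1 ^ j : MvPolynomial (Fin 2) A).IsHomogeneous (i + j) :=
  (isHomogeneous_C_mul_X_pow a 0 i).mul (isHomogeneous_X_pow 1 j)

lemma isHomogeneous_form : (form (C ∘ v) (X 0) (X 1) : MvPolynomial (Fin 2) A).IsHomogeneous 4 := by
  have h := ((((isHomogeneous_monomial_pair (v 4) 4 0).add
    (isHomogeneous_monomial_pair (v 3) 3 1)).add (isHomogeneous_monomial_pair (v 2) 2 2)).add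
    (isHomogeneous_monomial_pair (v 1) 1 3)).add (isHomogeneous_monomial_pair (v 0) 0 4)
  convert h using 1
  simp only [form, Function.comp]
  ring

lemma isHomogeneous_hessian :
    (hessian (C ∘ v) (X 0) (X 1) : MvPolynomial (Fin 2) A).IsHomogeneous 4 := by
  have h := ((((isHomogeneous_monomial_pair (3 * v 3 ^ 2 - 8 * v 4 * v 2) 4 0).add
    (isHomogeneous_monomial_pair (4 * (v 3 * v 2 - 6 * v 4 * v 1)) 3 1)).add
    (isHomogeneous_monomial_pair
      (2 * (2 * v 2 ^ 2 - 24 * v 4 * v 0 - 3 * v 3 * v 1)) 2 2)).add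
    (isHomogeneous_monomial_pair (4 * (v 2 * v 1 - 6 * v 3 * v 0)) 1 3)).add
    (isHomogeneous_monomial_pair (3 * v 1 ^ 2 - 8 * v 2 * v 0) 0 4)
  convert h using 1
  simp only [hessian, Function.comp, map_sub, map_mul, map_pow, map_ofNat]
  ring

lemma isHomogeneous_sextic :
    (sextic (C ∘ v) (X 0) (X 1) : MvPolynomial (Fin 2) A).IsHomogeneous 6 := by
  have h := ((((((isHomogeneous_monomial_pair
    (v 3 ^ 3 + 8 * v 4 ^ 2 * v 1 - 4 * v 4 * v 3 * v 2) 6 0).add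
    (isHomogeneous_monomial_pair
      (2 * (16 * v 4 ^ 2 * v 0 + 2 * v 4 * v 3 * v 1 - 4 * v 4 * v 2 ^ 2 + v 3 ^ 2 * v 2)) 5 1)).add
    (isHomogeneous_monomial_pair
      (5 * (8 * v 4 * v 3 * v 0 + v 3 ^ 2 * v 1 - 4 * v 4 * v 2 * v 1)) 4 2)).add
    (isHomogeneous_monomial_pair (20 * (v 3 ^ 2 * v 0 - v 4 * v 1 ^ 2)) 3 3)).sub
    (isHomogeneous_monomial_pair
      (5 * (8 * v 4 * v 1 * v 0 + v 3 * v 1 ^ 2 - 4 * v 3 * v 2 * v 0)) 2 4)).sub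
    (isHomogeneous_monomial_pair
      (2 * (16 * v 4 * v 0 ^ 2 + 2 * v 3 * v 1 * v 0 - 4 * v 2 ^ 2 * v 0 + v 2 * v 1 ^ 2)) 1 5)).sub
    (isHomogeneous_monomial_pair (v 1 ^ 3 + 8 * v 3 * v 0 ^ 2 - 4 * v 2 * v 1 * v 0) 0 6)
  convert h using 1
  simp only [sextic, Function.comp, map_add, map_sub, map_mul, map_pow, map_ofNat]
  ring

end Forms

/-! ### The Jacobian of a quartic and its doubling map. -/

section Resolvent

open WeierstrassCurve WeierstrassCurve.Affine WeierstrassCurve.Affine.Point Polynomial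

/-- The Weierstrass curve `Y ^ 2 = X ^ 3 - 27 * I * X - 27 * J` attached to a quartic form. -/
def resolventCurve {A : Type*} [CommRing A] (v : Fin 5 → A) : WeierstrassCurve A :=
  ⟨0, 0, 0, -27 * invI v, -27 * invJ v⟩

lemma map_resolventCurve {A B : Type*} [CommRing A] [CommRing B] (φ : A →+* B) (v : Fin 5 → A) :
    (resolventCurve v).map φ = resolventCurve (φ ∘ v) := by
  simp only [resolventCurve, WeierstrassCurve.map, map_mul, map_neg, _root_.map_zero, map_ofNat,
    map_invI, map_invJ]

/-- The quartic form `c * y * (4 * x ^ 3 + b₂ * x ^ 2 * y + 2 * b₄ * x * y ^ 2 + b₆ * y ^ 3)`. -/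
def weierstrassQuartic {A : Type*} [CommRing A] (W : WeierstrassCurve A) (c : A) : Fin 5 → A :=
  ![c * W.b₆, 2 * c * W.b₄, c * W.b₂, 4 * c, 0]

variable {F : Type*} [Field F] [CharZero F] {W : WeierstrassCurve F} {v : Fin 5 → F}
  {p q r s c : F}

/-- The invariants of the Weierstrass quartic are `I = c² c₄` and `J = 2 c³ c₆`, and `I`, `J` have
weights `4` and `6` in the determinant. So the resolvent curve is `W` with `x` shifted by `b₂ / 12`
and scaled by `36 c / (p s - q r)²`. -/
lemma resolventCurve_relations (hd : p * s - q * r ≠ 0)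
    (hw : transform v p q r s = weierstrassQuartic W c) :
    (resolventCurve v).b₂ = 36 * c / (p * s - q * r) ^ 2 * (W.b₂ + 12 * (-W.b₂ / 12)) ∧
    (resolventCurve v).b₄ = (36 * c / (p * s - q * r) ^ 2) ^ 2 *
      (W.b₄ + (-W.b₂ / 12) * W.b₂ + 6 * (-W.b₂ / 12) ^ 2) ∧
    (resolventCurve v).b₆ = (36 * c / (p * s - q * r) ^ 2) ^ 3 *
      (W.b₆ + 2 * (-W.b₂ / 12) * W.b₄ + (-W.b₂ / 12) ^ 2 * W.b₂ + 4 * (-W.b₂ / 12) ^ 3) ∧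
    (resolventCurve v).b₈ = (36 * c / (p * s - q * r) ^ 2) ^ 4 *
      (W.b₈ + 3 * (-W.b₂ / 12) * W.b₆ + 3 * (-W.b₂ / 12) ^ 2 * W.b₄ + (-W.b₂ / 12) ^ 3 * W.b₂ +
        3 * (-W.b₂ / 12) ^ 4) := by
  have hI := invI_transform v p q r s
  have hJ := invJ_transform v p q r s
  have h8 : W.b₈ = (W.b₂ * W.b₆ - W.b₄ ^ 2) / 4 := by
    rw [← W.b_relation]
    field_simp
  set d := p * s - q * r with hd_def
  have hI' : invI v = c ^ 2 * (W.b₂ ^ 2 - 24 * W.b₄) / d ^ 4 := by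
    rw [hw] at hI
    rw [eq_div_iff (pow_ne_zero 4 hd), mul_comm, ← hI]
    simp [invI, weierstrassQuartic]
    ring
  have hJ' : invJ v = c ^ 3 * (72 * W.b₂ * W.b₄ - 432 * W.b₆ - 2 * W.b₂ ^ 3) / d ^ 6 := by
    rw [hw] at hJ
    rw [eq_div_iff (pow_ne_zero 6 hd), mul_comm, ← hJ]
    simp [invJ, weierstrassQuartic]
    ring
  refine ⟨?_, ?_, ?_, ?_⟩
  · simp [WeierstrassCurve.b₂, resolventCurve]
    ring_nf
    simp
  · rw [WeierstrassCurve.b₄]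
    simp only [resolventCurve, hI']
    field_simp
    ring
  · rw [WeierstrassCurve.b₆]
    simp only [resolventCurve, hJ']
    field_simp
    ring
  · rw [WeierstrassCurve.b₈, h8]
    simp only [resolventCurve, hI']
    field_simp
    ring

lemma isElliptic_resolventCurve [W.IsElliptic] (hc : c ≠ 0) (hd : p * s - q * r ≠ 0)
    (hw : transform v p q r s = weierstrassQuartic W c) : (resolventCurve v).IsElliptic := by
  obtain ⟨h₂, h₄, h₆, h₈⟩ := resolventCurve_relations hd hw
  constructor
  have hΔ : (resolventCurve v).Δ = (36 * c / (p * s - q * r) ^ 2) ^ 6 * W.Δ := by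
    rw [WeierstrassCurve.Δ, WeierstrassCurve.Δ, h₂, h₄, h₆, h₈]
    have h8 : W.b₈ = (W.b₂ * W.b₆ - W.b₄ ^ 2) / 4 := by
      rw [← W.b_relation]
      field_simp
    rw [h8]
    field_simp
    ring
  rw [hΔ]
  exact (IsUnit.mk0 _ (pow_ne_zero 6 (div_ne_zero (mul_ne_zero (by norm_num) hc)
    (pow_ne_zero 2 hd)))).mul W.isUnit_Δ

omit [CharZero F] in
lemma form_eq_of_transform (hw : transform v p q r s = weierstrassQuartic W c) (x : F) :
    4 * form v (p * x + q) (r * x + s) = 4 * c * (W.xMul 2).2.eval x := by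
  have h := form_transform v p q r s x 1
  rw [hw, mul_one, mul_one] at h
  rw [← h, xMul_two]
  simp [weierstrassQuartic, form, xDouble]
  ring

/-- Together with `form_eq_of_transform` this gives `3H / (4f)` as the `x`-coordinate of `2P`, in
the shifted and scaled coordinate of the resolvent curve. By covariance it is enough to compute the
Hessian of the Weierstrass quartic. -/
lemma hessian_eq_of_transform (hd : p * s - q * r ≠ 0)
    (hw : transform v p q r s = weierstrassQuartic W c) (x : F) :
    3 * hessian v (p * x + q) (r * x + s) = 4 * c * (36 * c / (p * s - q * r) ^ 2 *
      ((W.xMul 2).1.eval x - (-W.b₂ / 12) * (W.xMul 2).2.eval x)) := by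
  have h := hessian_transform v p q r s x 1
  have h' : hessian (weierstrassQuartic W c) x 1 =
      c ^ 2 * (48 * (W.xMul 2).1.eval x + 4 * W.b₂ * (W.xMul 2).2.eval x) := by
    rw [xMul_two]
    simp [weierstrassQuartic, hessian, xDouble]
    linear_combination 12 * c ^ 2 * W.b_relation
  rw [hw, h', mul_one, mul_one] at h
  generalize hessian v (p * x + q) (r * x + s) = H at h ⊢
  field_simp
  linear_combination -36 * h

/-! ### Zeros of the covariant, and their number. -/

section Zeros

variable {O : Finset ℕ} {L : F[X]}

/-- The form attached to a quartic form `v` and a polynomial `L`. -/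
noncomputable def covariant {A : Type*} [CommRing A] (e n : ℕ) (L : A[X]) (v : Fin 5 → A)
    (x y : A) : A :=
  sextic v x y ^ e * homEval n L (3 * hessian v x y) (4 * form v x y)

/-- Where `f = 0` the syzygy reduces to `27 T² = H³`, and the homogenized monic polynomial to a
power of `3H`. This keeps the zeros away from the branch points. -/
lemma covariant_ne_zero_of_form_eq_zero (hL : L.Monic) (e : ℕ) {x y : F} (hf : form v x y = 0)
    (hh : hessian v x y ≠ 0) : covariant e L.natDegree L v x y ≠ 0 := by
  rw [covariant, hf, mul_zero, homEval_zero_right hL]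
  refine mul_ne_zero (pow_ne_zero _ fun hs => ?_) (pow_ne_zero _ (mul_ne_zero three_ne_zero hh))
  have h := syzygy v x y
  rw [hs, hf] at h
  apply pow_ne_zero 3 hh
  linear_combination -h

variable [DecidableEq F] [IsAlgClosed F]

/-- Orders are compared through the zeros of the denominators of `x(nP)`, which an affine change of
`x` multiplies by nonzero constants; the `y`-coordinates of the two curves play no role. -/
lemma mem_xOfOrder_resolventCurve_iff [W.IsElliptic] (hc : c ≠ 0) (hd : p * s - q * r ≠ 0)
    (hw : transform v p q r s = weierstrassQuartic W c) (x : F) (d : ℕ) :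
    36 * c / (p * s - q * r) ^ 2 * (x - (-W.b₂ / 12)) ∈ (resolventCurve v).xOfOrder d ↔
      x ∈ W.xOfOrder d := by
  have := isElliptic_resolventCurve hc hd hw
  obtain ⟨h₂, h₄, h₆, h₈⟩ := resolventCurve_relations hd hw
  obtain ⟨y, h⟩ := W.exists_point x
  obtain ⟨y', h'⟩ := (resolventCurve v).exists_point
    (36 * c / (p * s - q * r) ^ 2 * (x - (-W.b₂ / 12)))
  rw [mem_xOfOrder_iff h, mem_xOfOrder_iff h']
  suffices addOrderOf (some _ _ h') = addOrderOf (some _ _ h) by rw [this]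
  rw [addOrderOf_eq_addOrderOf_iff]
  intro n
  rw [nsmul_some_eq_zero_iff, nsmul_some_eq_zero_iff]
  obtain ⟨a, ha, -, e⟩ := exists_evalPair_xMul_of_affine (div_ne_zero
    (mul_ne_zero (by norm_num) hc) (pow_ne_zero 2 hd)) h₂ h₄ h₆ h₈ x n
  rw [e, mul_eq_zero, or_iff_right ha]

/-- In terms of `t = 3H / (4f)` the syzygy reads `729 T² = 16 f³ ψ(t)`, with `ψ` the two-division
cubic of the resolvent curve. So `T` detects doubles of order two with half the degree that `ψ`
would give. -/
lemma sextic_eq_zero_iff [(resolventCurve v).IsElliptic] {x y t : F} (hf : form v x y ≠ 0)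
    (ht : 3 * hessian v x y = 4 * form v x y * t) :
    sextic v x y = 0 ↔ t ∈ (resolventCurve v).xOfOrder 2 := by
  obtain ⟨u, h⟩ := (resolventCurve v).exists_point t
  rw [mem_xOfOrder_iff h, addOrderOf_eq_prime_iff, and_iff_left (some_ne_zero h),
    nsmul_some_eq_zero_iff, xMul_two]
  have hs := syzygy v x y
  have hh : hessian v x y = 4 * form v x y * t / 3 := by
    rw [← ht]
    field_simp
  rw [hh] at hs
  have key : 729 * sextic v x y ^ 2 = 16 * form v x y ^ 3 *
      (4 * t ^ 3 + (resolventCurve v).b₂ * t ^ 2 + 2 * (resolventCurve v).b₄ * t +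
        (resolventCurve v).b₆) := by
    simp only [b₂, b₄, b₆, resolventCurve]
    linear_combination 27 * hs
  simp only [xDouble, eval_add, eval_mul, eval_pow, eval_X, eval_C, one_pow, mul_one,
    eval_ofNat]
  constructor
  · intro h0
    rw [h0] at key
    refine (mul_eq_zero.1 (key.symm.trans (by ring))).resolve_left
      (mul_ne_zero (by norm_num) (pow_ne_zero 3 hf))
  · intro h0
    rw [h0, mul_zero] at key
    simpa using key

/-- The zeros of the covariant, in terms of an elliptic curve branched over the zeros of `v`. -/
theorem covariant_eq_zero_iff [W.IsElliptic] (hc : c ≠ 0) (hd : p * s - q * r ≠ 0)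
    (hw : transform v p q r s = weierstrassQuartic W c) (hO : ∀ d ∈ O, 2 ≤ d)
    (hL : IsProdOver L (⋃ d ∈ O.erase 2, (resolventCurve v).xOfOrder d)) (P : W.toAffine.Point) :
    covariant (if 2 ∈ O then 1 else 0) L.natDegree L v (p * P.xRep 0 + q * P.xRep 1)
      (r * P.xRep 0 + s * P.xRep 1) = 0 ↔ addOrderOf (2 • P) ∈ O := by
  have := isElliptic_resolventCurve hc hd hw
  have h1 : 1 ∉ O := fun h => by
    have := hO 1 h
    lia
  rcases P with _ | ⟨x, y, h⟩
  · rw [← zero_def]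
    simp only [smul_zero, addOrderOf_zero, h1, iff_false]
    refine covariant_ne_zero_of_form_eq_zero hL.monic _ ?_ ?_
    · have := form_transform v p q r s 1 0
      rw [hw] at this
      simp only [xRep_zero, Matrix.cons_val_zero, Matrix.cons_val_one]
      rw [← this]
      simp [form, weierstrassQuartic]
    · have := hessian_transform v p q r s 1 0
      rw [hw] at this
      simp only [xRep_zero, Matrix.cons_val_zero, Matrix.cons_val_one]
      intro h0
      rw [h0, mul_zero] at this
      simp [hessian, weierstrassQuartic, hc] at this
  · simp only [xRep_some, Matrix.cons_val_zero, Matrix.cons_val_one, mul_one]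
    have hf := form_eq_of_transform hw x
    have hh := hessian_eq_of_transform hd hw x
    by_cases h2 : 2 • some x y h = 0
    · rw [h2, addOrderOf_zero, iff_false_right h1]
      have hq := (nsmul_some_eq_zero_iff h 2).1 h2
      refine covariant_ne_zero_of_form_eq_zero hL.monic _ ?_ ?_
      · rw [hq, mul_zero] at hf
        exact (mul_eq_zero.1 hf).resolve_left (by norm_num)
      · intro h0
        rw [h0, hq, mul_zero, mul_zero, sub_zero, eq_comm] at hh
        have := eval_xMul_ne_zero (W := W) x 2 hq
        simp [hc, hd, this] at hh
    · have hq : (W.xMul 2).2.eval x ≠ 0 := fun h0 => h2 ((nsmul_some_eq_zero_iff h 2).2 h0)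
      obtain ⟨x₂, y₂, h₂, e⟩ : ∃ x₂ y₂, ∃ h₂ : W.toAffine.Nonsingular x₂ y₂,
          2 • some x y h = some x₂ y₂ h₂ := by
        rcases hP : 2 • some x y h with _ | ⟨x₂, y₂, h₂⟩
        · exact absurd hP h2
        · exact ⟨x₂, y₂, h₂, rfl⟩
      have hx₂ := (xRep_nsmul_some_eq_iff h 2 x₂).1 (by rw [e, xRep_some])
      set t := 36 * c / (p * s - q * r) ^ 2 * (x₂ - (-W.b₂ / 12)) with ht
      have hmem := mem_xOfOrder_resolventCurve_iff hc hd hw x₂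
      rw [← ht] at hmem
      simp only [mem_xOfOrder_iff h₂] at hmem
      have hA : 3 * hessian v (p * x + q) (r * x + s) = 4 * form v (p * x + q) (r * x + s) * t := by
        rw [hf, hh, hx₂, ht]
        ring
      have hB : 4 * form v (p * x + q) (r * x + s) ≠ 0 := by
        rw [hf]
        exact mul_ne_zero (mul_ne_zero (by norm_num) hc) hq
      rw [covariant, hA, homEval_mul_left _ _ le_rfl, mul_eq_zero, mul_eq_zero,
        or_iff_right (pow_ne_zero _ hB), hL.eval_eq_zero_iff, e]
      simp only [Set.mem_iUnion, exists_prop, hmem, exists_eq_right', Finset.mem_erase]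
      split_ifs with hO2
      · rw [pow_one, sextic_eq_zero_iff (right_ne_zero_of_mul hB) hA, hmem]
        constructor
        · rintro (h | h)
          · rwa [h]
          · exact h.2
        · intro h
          by_cases h' : addOrderOf (some x₂ y₂ h₂) = 2
          · exact Or.inl h'
          · exact Or.inr ⟨h', h⟩
      · simp only [pow_zero, one_ne_zero, false_or, and_iff_right_iff_imp]
        exact fun h h' => hO2 (h' ▸ h)

variable (W) in
lemma ncard_preimage_two_nsmul [W.IsElliptic] {T : Set W.toAffine.Point} (hT : T.Finite) :
    {P : W.toAffine.Point | 2 • P ∈ T}.ncard = 4 * T.ncard := by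
  classical
  have hfib (Q : W.toAffine.Point) : {P : W.toAffine.Point | 2 • P = Q}.ncard = 4 := by
    obtain ⟨P₀, hP₀ : 2 • P₀ = Q⟩ := nsmul_surjective (W := W) two_ne_zero Q
    rw [show 4 = 2 ^ 2 by rfl, ← W.ncard_torsion two_ne_zero]
    refine Set.ncard_congr (fun P _ => P - P₀) ?_ ?_ ?_
    · intro P hP
      rw [Set.mem_ofPred_eq] at hP ⊢
      rw [smul_sub, hP, hP₀, sub_self]
    · intro P P' _ _ h
      simpa using h
    · intro P hP
      rw [Set.mem_ofPred_eq] at hP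
      exact ⟨P + P₀, by rw [Set.mem_ofPred_eq, smul_add, hP, hP₀, zero_add], by simp⟩
  have hfin (Q : W.toAffine.Point) : {P : W.toAffine.Point | 2 • P = Q}.Finite :=
    Set.finite_of_ncard_ne_zero (by rw [hfib]; norm_num)
  have hpre : {P : W.toAffine.Point | 2 • P ∈ T}.Finite := by
    refine (hT.biUnion fun Q _ => hfin Q).subset fun P hP => ?_
    simpa using hP
  rw [Set.ncard_eq_toFinset_card _ hpre, Set.ncard_eq_toFinset_card _ hT,
    Finset.card_eq_sum_card_fiberwise (f := fun P => 2 • P) (t := hT.toFinset)]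
  · rw [Finset.sum_const_nat (m := 4), mul_comm]
    intro Q hQ
    rw [← hfib Q, ← Set.ncard_coe_finset]
    congr 1
    ext P
    simp only [Finset.coe_filter, Set.Finite.mem_toFinset, Set.mem_ofPred_eq,
      and_iff_right_iff_imp]
    rintro rfl
    simpa using hQ
  · intro P hP
    simpa using hP

variable (W) in
lemma ncard_addOrderOf_two_nsmul_mem [W.IsElliptic] (hO : ∀ d ∈ O, 2 ≤ d) :
    {P : W.toAffine.Point | addOrderOf (2 • P) ∈ O}.ncard =
      4 * ∑ d ∈ O, {P : W.toAffine.Point | addOrderOf P = d}.ncard := by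
  have hfin : {P : W.toAffine.Point | addOrderOf P ∈ O}.Finite := by
    refine (O.finite_toSet.biUnion fun d hd => W.finite_addOrderOf (d := d) fun h => ?_).subset
      fun P hP => ?_
    · have := hO d hd
      lia
    · simpa using hP
  rw [← ncard_addOrderOf_mem_eq_sum hfin]
  exact ncard_preimage_two_nsmul W hfin

/-- The number of zeros of the covariant form. -/
lemma two_mul_degree_eq [W.IsElliptic] {W' : WeierstrassCurve F} [W'.IsElliptic]
    (hO : ∀ d ∈ O, 2 ≤ d) (hL : IsProdOver L (⋃ d ∈ O.erase 2, W'.xOfOrder d)) :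
    2 * (6 * (if 2 ∈ O then 1 else 0) + 4 * L.natDegree) =
      {P : W.toAffine.Point | addOrderOf (2 • P) ∈ O}.ncard := by
  have hne {d : ℕ} (hd : d ∈ O) : d ≠ 0 := fun h => by
    have := hO d hd
    lia
  have hW (d : ℕ) (hd : d ∈ O) : {P : W.toAffine.Point | addOrderOf P = d}.ncard =
      {P : W'.toAffine.Point | addOrderOf P = d}.ncard := by
    rw [W.ncard_addOrderOf (hne hd), W'.ncard_addOrderOf (hne hd)]
  rw [ncard_addOrderOf_two_nsmul_mem W hO, Finset.sum_congr rfl hW, hL.natDegree_eq,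
    ncard_iUnion_xOfOrder _ _ (fun h => hne (Finset.mem_of_mem_erase h) rfl)]
  have hsum : ∑ d ∈ O.erase 2, {P : W'.toAffine.Point | addOrderOf P = d}.ncard =
      2 * ∑ d ∈ O.erase 2, (W'.xOfOrder d).ncard := by
    rw [Finset.mul_sum]
    refine Finset.sum_congr rfl fun d hd => W'.ncard_addOrderOf_eq_two_mul ?_
      (W'.finite_addOrderOf (hne (Finset.mem_of_mem_erase hd)))
    have := hO d (Finset.mem_of_mem_erase hd)
    have := Finset.ne_of_mem_erase hd
    lia
  split_ifs with h2
  · rw [← Finset.add_sum_erase _ _ h2, hsum, W'.ncard_addOrderOf_two_eq_three]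
    ring
  · rw [Finset.erase_eq_of_notMem h2] at hsum ⊢
    rw [hsum]
    ring

end Zeros

/-- For a finite set `O` of orders, there is a covariant of binary quartic forms whose zeros are the
images of the points `P` such that the order of `2 • P` is in `O`. -/
theorem exists_covariantForm [IsAlgClosed F] [DecidableEq F] {O : Finset ℕ} (hO : ∀ d ∈ O, 2 ≤ d) :
    ∃ (N : ℕ) (G : MvPolynomial (Fin 2) (MvPolynomial (Fin 5) F)), G.IsHomogeneous N ∧
      ∀ (v : Fin 5 → F) (W : WeierstrassCurve F) (p q r s c : F), W.IsElliptic → c ≠ 0 →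
        p * s - q * r ≠ 0 → transform v p q r s = weierstrassQuartic W c →
        2 * N = {P : W.toAffine.Point | addOrderOf (2 • P) ∈ O}.ncard ∧
        ∀ P : W.toAffine.Point, MvPolynomial.eval
          ![p * P.xRep 0 + q * P.xRep 1, r * P.xRep 0 + s * P.xRep 1]
          (MvPolynomial.map (MvPolynomial.eval v) G) = 0 ↔ addOrderOf (2 • P) ∈ O := by
  choose! L hLm hL using fun d (hd : d ∈ O.erase 2) => exists_primitiveDivisionPolynomial (F := F)
    (resolventCurve (MvPolynomial.X : Fin 5 → MvPolynomial (Fin 5) F))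
    (hO d (Finset.mem_of_mem_erase hd))
  set T := ∏ d ∈ O.erase 2, L d with hT
  have hTm : T.Monic := monic_prod_of_monic _ _ hLm
  set e := if 2 ∈ O then 1 else 0 with he
  refine ⟨6 * e + 4 * T.natDegree, covariant e T.natDegree (T.map MvPolynomial.C)
    (MvPolynomial.C ∘ MvPolynomial.X) (MvPolynomial.X 0) (MvPolynomial.X 1), ?_, ?_⟩
  · refine ((isHomogeneous_sextic _).pow e).mul (MvPolynomial.IsHomogeneous.homEval ?_ ?_ _ _)
    · exact (isHomogeneous_hessian _).C_mul 3
    · exact (isHomogeneous_form _).C_mul 4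
  · intro v W p q r s c hW hc hd hw
    have hW' := isElliptic_resolventCurve hc hd hw
    -- The form is built from the generic quartic, whose coefficients are the five variables, and
    -- `v` is a specialization of it.
    have hmap : (resolventCurve (MvPolynomial.X : Fin 5 → MvPolynomial (Fin 5) F)).map
        (MvPolynomial.aeval v : MvPolynomial (Fin 5) F →ₐ[F] F) = resolventCurve v := by
      rw [map_resolventCurve]
      congr 1
      ext i
      simp
    have hTv : IsProdOver (T.map (MvPolynomial.eval v))
        (⋃ d ∈ O.erase 2, (resolventCurve v).xOfOrder d) := by
      rw [hT, Polynomial.map_prod]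
      refine IsProdOver.prod _ (fun d hd => ?_)
        fun d _ e _ h => (resolventCurve v).disjoint_xOfOrder h
      have := hL d hd (MvPolynomial.aeval v)
      rw [hmap] at this
      exact this hW'
    have hdeg := hTm.natDegree_map (MvPolynomial.eval v)
    refine ⟨?_, fun P => ?_⟩
    · rw [← two_mul_degree_eq (W := W) hO hTv, hdeg]
    · rw [← covariant_eq_zero_iff hc hd hw hO hTv P, hdeg, ← he]
      set x := p * P.xRep 0 + q * P.xRep 1
      set y := r * P.xRep 0 + s * P.xRep 1
      set ψ : MvPolynomial (Fin 2) (MvPolynomial (Fin 5) F) →+* F :=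
        (MvPolynomial.eval ![x, y]).comp (MvPolynomial.map (MvPolynomial.eval v)) with hψ
      have hC : ψ ∘ MvPolynomial.C ∘ MvPolynomial.X = v := by
        ext i
        simp [hψ]
      have hψC : ψ.comp MvPolynomial.C = MvPolynomial.eval v := by
        ext <;> simp [hψ]
      have hx : ψ (MvPolynomial.X 0) = x := by simp [hψ]
      have hy : ψ (MvPolynomial.X 1) = y := by simp [hψ]
      rw [← RingHom.comp_apply, ← hψ, covariant, map_mul, map_pow, map_homEval, map_mul, map_mul,
        map_form, map_hessian, map_sextic, hC, hx, hy, Polynomial.map_map, hψC, map_ofNat,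
        map_ofNat]
      rfl

end Resolvent

end BinaryQuartic

/-! ### Homogeneous components. -/

namespace MvPolynomial

lemma IsHomogeneous.eval_const_smul {σ R : Type*} [CommSemiring R] {P : MvPolynomial σ R} {n : ℕ}
    (hP : P.IsHomogeneous n) (t : R) (v : σ → R) : eval (t • v) P = t ^ n * eval v P := by
  rw [eval_eq, eval_eq, Finset.mul_sum]
  refine Finset.sum_congr rfl fun d hd => ?_
  have h : ∏ i ∈ d.support, t ^ d i = t ^ n := by
    rw [Finset.prod_pow_eq_pow_sum, hP.degree_eq_sum_deg_support hd]
  simp only [Pi.smul_apply, smul_eq_mul, mul_pow, Finset.prod_mul_distrib, h]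
  ring

/-- If a polynomial vanishes on a punctured line, so do its homogeneous components. -/
lemma eval_homogeneousComponent_eq_zero {σ K : Type*} [Field K] [Infinite K]
    {P : MvPolynomial σ K} {v : σ → K} (h : ∀ t : K, t ≠ 0 → eval (t • v) P = 0) (d : ℕ) :
    eval v (homogeneousComponent d P) = 0 := by
  set q : Polynomial K := ∑ i ∈ Finset.range (P.totalDegree + 1),
    Polynomial.monomial i (eval v (homogeneousComponent i P)) with hq
  have hqe (t : K) : q.eval t = eval (t • v) P := by
    conv_rhs => rw [← sum_homogeneousComponent P]
    rw [map_sum, hq, Polynomial.eval_finsetSum]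
    refine Finset.sum_congr rfl fun i _ => ?_
    rw [(homogeneousComponent_isHomogeneous i P).eval_const_smul, Polynomial.eval_monomial,
      mul_comm]
  have hq0 : q = 0 := by
    refine Polynomial.eq_zero_of_infinite_isRoot q ((Set.finite_singleton 0).infinite_compl.mono ?_)
    intro t ht
    rw [Set.mem_ofPred_eq, Polynomial.IsRoot, hqe, h t ht]
  rcases lt_or_ge P.totalDegree d with hd | hd
  · rw [homogeneousComponent_eq_zero d P hd, map_zero]
  · have := congrArg (Polynomial.coeff · d) hq0
    simpa [hq, Polynomial.finsetSum_coeff, Polynomial.coeff_monomial, Nat.lt_succ_iff, hd]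
      using this

end MvPolynomial

/-! ### Binary forms, configurations and regular maps. -/

namespace ConfCP1

section BinaryForms

open MvPolynomial

lemma eval_linForm_rep_eq_zero_iff {p q : CP1} : eval q.rep (linForm p) = 0 ↔ p = q := by
  have he : eval q.rep (linForm p) = p.rep 1 * q.rep 0 - p.rep 0 * q.rep 1 := by simp [linForm]
  rw [he]
  constructor
  · intro h
    rw [← p.mk_rep, ← q.mk_rep, eq_comm, Projectivization.mk_eq_mk_iff']
    by_cases h0 : p.rep 0 = 0
    · have h1 : p.rep 1 ≠ 0 := fun h1 => p.rep_nonzero (by ext i; fin_cases i <;> assumption)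
      have hq : q.rep 0 = 0 := by
        rw [h0] at h
        simpa [h1] using h
      refine ⟨q.rep 1 / p.rep 1, ?_⟩
      ext i
      fin_cases i
      · simp [h0, hq]
      · simp [h1]
    · refine ⟨q.rep 0 / p.rep 0, ?_⟩
      ext i
      fin_cases i
      · simp [h0]
      · simp only [Fin.mk_one, Pi.smul_apply, smul_eq_mul]
        field_simp
        linear_combination h
  · rintro rfl
    ring

/-- Restriction to the line through the origin that corresponds to `p`. -/
noncomputable def restrictLine (p : CP1) : MvPolynomial (Fin 2) ℂ →ₐ[ℂ] Polynomial ℂ :=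
  aeval fun i => Polynomial.C (p.rep i) * Polynomial.X

/-- With `c`, `d` chosen so that `c X + d Y` is `1` at the representative of `p`, sending the
parameter of the line to `c X + d Y` inverts the restriction modulo `linForm p`. So `linForm p`
generates the kernel of a map to a domain, whence its primality. -/
lemma linForm_dvd_iff_restrictLine_eq_zero {p : CP1} {G : MvPolynomial (Fin 2) ℂ} :
    linForm p ∣ G ↔ restrictLine p G = 0 := by
  constructor
  · rintro ⟨H, rfl⟩
    rw [map_mul, show restrictLine p (linForm p) = 0 by simp [restrictLine, linForm]; ring,
      zero_mul]
  · intro h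
    obtain ⟨c, d, hcd⟩ : ∃ c d : ℂ, c * p.rep 0 + d * p.rep 1 = 1 := by
      by_cases h0 : p.rep 0 = 0
      · have h1 : p.rep 1 ≠ 0 := fun h1 => p.rep_nonzero (by ext i; fin_cases i <;> assumption)
        exact ⟨0, (p.rep 1)⁻¹, by simp [h1]⟩
      · exact ⟨(p.rep 0)⁻¹, 0, by simp [h0]⟩
    have hC : (C c * C (p.rep 0) + C d * C (p.rep 1) : MvPolynomial (Fin 2) ℂ) = 1 := by
      rw [← C_mul, ← C_mul, ← C_add, hcd, C_1]
    set I := Ideal.span {linForm p}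
    set ψ : Polynomial ℂ →ₐ[ℂ] MvPolynomial (Fin 2) ℂ := Polynomial.aeval (C c * X 0 + C d * X 1)
    have key :
        (Ideal.Quotient.mkₐ ℂ I).comp (ψ.comp (restrictLine p)) = Ideal.Quotient.mkₐ ℂ I := by
      ext i
      simp only [AlgHom.comp_apply, Ideal.Quotient.mkₐ_eq_mk, restrictLine, aeval_X, ψ, map_mul,
        Polynomial.aeval_C, Polynomial.aeval_X, ← MvPolynomial.algebraMap_eq]
      rw [← map_mul, Ideal.Quotient.mk_eq_mk_iff_sub_mem, Ideal.mem_span_singleton]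
      fin_cases i
      · exact ⟨-C d, by
          simp only [linForm, MvPolynomial.algebraMap_eq, Fin.zero_eta]
          linear_combination (X 0) * hC⟩
      · exact ⟨C c, by
          simp only [linForm, MvPolynomial.algebraMap_eq, Fin.mk_one]
          linear_combination (X 1) * hC⟩
    have := DFunLike.congr_fun key G
    rw [AlgHom.comp_apply, AlgHom.comp_apply, h, map_zero, map_zero, eq_comm,
      Ideal.Quotient.mkₐ_eq_mk, Ideal.Quotient.eq_zero_iff_mem, Ideal.mem_span_singleton] at this
    exact this

lemma prime_linForm (p : CP1) : Prime (linForm p) := by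
  refine ⟨linForm_ne_zero p, fun h => ?_, fun G H h => ?_⟩
  · rw [isUnit_iff_dvd_one, linForm_dvd_iff_restrictLine_eq_zero, map_one] at h
    exact one_ne_zero h
  · simpa only [linForm_dvd_iff_restrictLine_eq_zero, map_mul, mul_eq_zero] using h

lemma linForm_dvd_of_eval_rep_eq_zero {p : CP1} {G : MvPolynomial (Fin 2) ℂ} {n : ℕ}
    (hG : G.IsHomogeneous n) (h : eval p.rep G = 0) : linForm p ∣ G := by
  rw [linForm_dvd_iff_restrictLine_eq_zero]
  refine Polynomial.funext fun t => ?_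
  have : (Polynomial.evalRingHom t).comp (restrictLine p : _ →+* Polynomial ℂ) =
      eval (t • p.rep) := by
    ext i
    · simp
    · simp [restrictLine, mul_comm t]
  have h2 := DFunLike.congr_fun this G
  rw [hG.eval_const_smul, h, mul_zero] at h2
  simpa using h2

lemma prod_linForm_dvd (T : Finset CP1) {G : MvPolynomial (Fin 2) ℂ}
    (h : ∀ p ∈ T, linForm p ∣ G) : ∏ p ∈ T, linForm p ∣ G := by
  classical
  induction T using Finset.induction_on generalizing G with
  | empty => simp
  | insert p T hp ih =>
    obtain ⟨H, rfl⟩ := h p (Finset.mem_insert_self p T)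
    rw [Finset.prod_insert hp]
    refine mul_dvd_mul_left _ (ih fun q hq => ?_)
    refine ((prime_linForm q).dvd_or_dvd (h q (Finset.mem_insert_of_mem hq))).resolve_left ?_
    rintro ⟨K, hK⟩
    have : eval q.rep (linForm p) = 0 := by
      rw [hK, map_mul, eval_linForm_rep_eq_zero_iff.2 rfl, zero_mul]
    exact hp (eval_linForm_rep_eq_zero_iff.1 this ▸ hq)

/-- A form of degree `n` that vanishes at `n` given points is the product of their linear forms, up
to a constant. -/
lemma exists_eq_C_mul_binForm {n : ℕ} {S : Conf n} {G : MvPolynomial (Fin 2) ℂ}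
    (hG : G.IsHomogeneous n) (h : ∀ p ∈ S.val, eval p.rep G = 0) :
    ∃ c, G = C c * binForm S := by
  have hb := binForm_isHomogeneous S
  have hb0 : binForm S ≠ 0 := Finset.prod_ne_zero_iff.2 fun p _ => linForm_ne_zero p
  obtain ⟨H, rfl⟩ : binForm S ∣ G := prod_linForm_dvd _ fun p hp =>
    linForm_dvd_of_eval_rep_eq_zero hG (h p hp)
  rcases eq_or_ne H 0 with rfl | hH
  · exact ⟨0, by simp⟩
  · have := hG.totalDegree (mul_ne_zero hb0 hH)
    rw [totalDegree_mul_of_isDomain hb0 hH, hb.totalDegree hb0] at this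
    rw [totalDegree_eq_zero_iff_eq_C.1 (by omega : H.totalDegree = 0)]
    exact ⟨_, mul_comm _ _⟩

lemma eval_eq_sum_coeff {R : Type*} [CommSemiring R] {n : ℕ} {G : MvPolynomial (Fin 2) R}
    (hG : G.IsHomogeneous n) (w : Fin 2 → R) :
    eval w G = ∑ i : Fin (n + 1),
      G.coeff (Finsupp.single 0 (i : ℕ) + Finsupp.single 1 (n - i)) *
        (w 0 ^ (i : ℕ) * w 1 ^ (n - i)) := by
  classical
  rw [eval_eq']
  simp only [Fin.prod_univ_two]
  symm
  refine Finset.sum_bij_ne_zero (fun i _ _ => Finsupp.single 0 (i : ℕ) + Finsupp.single 1 (n - i))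
    (fun i _ h => ?_) (fun i _ _ j _ _ h => ?_) (fun d hd h => ?_) (fun i _ _ => ?_)
  · exact mem_support_iff.2 (left_ne_zero_of_mul h)
  · have := DFunLike.congr_fun h 0
    simpa [Fin.ext_iff] using this
  · have hdeg := hG.degree_eq_sum_deg_support hd
    rw [← Finsupp.degree_apply, Finsupp.degree_eq_sum, Fin.sum_univ_two] at hdeg
    have hd' : Finsupp.single 0 (d 0) + Finsupp.single 1 (n - d 0) = d := by
      ext i
      fin_cases i
      · simp
      · simp only [Fin.mk_one, Finsupp.add_apply]
        simp
        omega
    refine ⟨⟨d 0, by omega⟩, Finset.mem_univ _, ?_, hd'⟩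
    dsimp only
    rwa [hd', show n - d 0 = d 1 by omega]
  · simp

lemma eval_binForm_eq_zero_iff {n : ℕ} {S : Conf n} {p : CP1} :
    eval p.rep (binForm S) = 0 ↔ p ∈ S.val := by
  simp [binForm, map_prod, Finset.prod_eq_zero_iff, eval_linForm_rep_eq_zero_iff]

end BinaryForms

/-- A map of configurations is regular if its coefficients are given, up to a common factor, by
polynomials in the coefficients of the argument; these need not be homogeneous. -/
theorem isRegular_of_eval_eq {n N : ℕ} {f : Conf n → Conf N}
    (F : Fin (N + 1) → MvPolynomial (Fin (n + 1)) ℂ)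
    (hF : ∀ (S : Conf n) (t : ℂ), t ≠ 0 → ∃ c : ℂ, c ≠ 0 ∧
      ∀ j, MvPolynomial.eval (t • coeffs S) (F j) = c * coeffs (f S) j) :
    IsRegular Conf.toProj fun S => (f S).toProj := by
  have hrep (S : Conf n) : ∃ t : ℂ, t ≠ 0 ∧ S.toProj.rep = t • coeffs S := by
    obtain ⟨t, ht⟩ := Projectivization.exists_smul_eq_mk_rep ℂ (coeffs S) (coeffs_ne_zero S)
    exact ⟨t, t.ne_zero, ht.symm⟩
  intro S₀
  obtain ⟨t₀, ht₀, hS₀⟩ := hrep S₀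
  obtain ⟨j, hj⟩ : ∃ j, MvPolynomial.eval S₀.toProj.rep (F j) ≠ 0 := by
    obtain ⟨c, hc, h⟩ := hF S₀ t₀ ht₀
    obtain ⟨j, hj⟩ := Function.ne_iff.1 (coeffs_ne_zero (f S₀))
    exact ⟨j, by rw [hS₀, h]; exact mul_ne_zero hc hj⟩
  obtain ⟨d, hd⟩ : ∃ d, MvPolynomial.eval S₀.toProj.rep
      (MvPolynomial.homogeneousComponent d (F j)) ≠ 0 := by
    by_contra! h
    rw [← MvPolynomial.sum_homogeneousComponent (F j), map_sum, 
      Finset.sum_eq_zero fun i _ => h i] at hj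
    exact hj rfl
  -- The open set is the nonvanishing locus of the `d`-th component of `F j`, itself one of the
  -- coordinates `Q`, so these have no common zero there.
  refine ⟨_, fun i => MvPolynomial.homogeneousComponent d (F i), d, d,
    MvPolynomial.homogeneousComponent_isHomogeneous d (F j),
    fun i => MvPolynomial.homogeneousComponent_isHomogeneous d (F i), hd, fun S hS => ?_⟩
  refine ⟨fun h => hS (congrFun h j), ?_⟩
  obtain ⟨t, ht, hSt⟩ := hrep S
  -- The vectors `F` and `coeffs (f S)` are proportional along the whole punctured line through the
  -- representative; their `2 × 2` minors vanish there, hence also in each degree.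
  have key (a b : Fin (N + 1)) : coeffs (f S) b * MvPolynomial.eval S.toProj.rep
      (MvPolynomial.homogeneousComponent d (F a)) = coeffs (f S) a * MvPolynomial.eval S.toProj.rep
      (MvPolynomial.homogeneousComponent d (F b)) := by
    have := MvPolynomial.eval_homogeneousComponent_eq_zero
      (P := MvPolynomial.C (coeffs (f S) b) * F a - MvPolynomial.C (coeffs (f S) a) * F b)
      (v := S.toProj.rep) (fun u hu => by
        obtain ⟨c, hc, h⟩ := hF S (u * t) (mul_ne_zero hu ht)
        rw [hSt, smul_smul, map_sub, map_mul, map_mul, MvPolynomial.eval_C, MvPolynomial.eval_C,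
          h, h]
        ring) d
    rw [map_sub, MvPolynomial.homogeneousComponent_C_mul, MvPolynomial.homogeneousComponent_C_mul,
      map_sub, map_mul, map_mul, MvPolynomial.eval_C, MvPolynomial.eval_C, sub_eq_zero] at this
    exact this
  have hw : coeffs (f S) j ≠ 0 := by
    intro h
    apply coeffs_ne_zero (f S)
    ext b
    have := key j b
    rw [h, zero_mul, mul_eq_zero] at this
    exact this.resolve_right hS
  refine (Projectivization.mk_eq_mk_iff' ..).2 ?_
  refine ⟨coeffs (f S) j / MvPolynomial.eval S.toProj.rep
    (MvPolynomial.homogeneousComponent d (F j)), ?_⟩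
  ext b
  rw [Pi.smul_apply, smul_eq_mul, div_mul_eq_mul_div, div_eq_iff hS, key j b]

end ConfCP1

/-! ### Double covers of the projective line by elliptic curves. -/

namespace ConfCP1

section DoubleCover

open WeierstrassCurve.Affine WeierstrassCurve.Affine.Point

lemma xMap_eq (W : WeierstrassCurve ℂ) (P : W.toAffine.Point) :
    xMap W P = Projectivization.mk ℂ P.xRep P.xRep_ne_zero := by
  cases P <;> rfl

lemma xMap_eq_xMap_iff {W : WeierstrassCurve ℂ} {P Q : W.toAffine.Point} :
    xMap W P = xMap W Q ↔ P = Q ∨ P = -Q := by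
  rw [← xRep_eq_xRep_iff, xMap_eq, xMap_eq, Projectivization.mk_eq_mk_iff']
  refine ⟨fun ⟨a, ha⟩ => ?_, fun h => ⟨1, by rw [h, one_smul]⟩⟩
  have h0 := congrFun ha 0
  have h1 := congrFun ha 1
  rcases P with _ | ⟨x, y, h⟩ <;> rcases Q with _ | ⟨x', y', h'⟩ <;>
    simp_all [← zero_def, xRep_zero, xRep_some]

variable {W : WeierstrassCurve ℂ} {g : PGL(2, ℂ)}

lemma doubleCover_eq_iff {P Q : W.toAffine.Point} :
    doubleCover W g P = doubleCover W g Q ↔ P = Q ∨ P = -Q := by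
  rw [doubleCover, doubleCover, smul_left_cancel_iff, xMap_eq_xMap_iff]

lemma xMap_surjective (W : WeierstrassCurve ℂ) [W.IsElliptic] : Function.Surjective (xMap W) := by
  intro z
  induction z using Projectivization.ind with | h v hv
  by_cases h1 : v 1 = 0
  · refine ⟨0, ?_⟩
    rw [xMap_eq, Projectivization.mk_eq_mk_iff']
    have h0 : v 0 ≠ 0 := fun h0 => hv (by ext i; fin_cases i <;> assumption)
    refine ⟨(v 0)⁻¹, ?_⟩
    ext i
    fin_cases i <;> simp [xRep_zero, h0, h1]
  · obtain ⟨y, h⟩ := W.exists_point (v 0 / v 1)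
    refine ⟨some _ y h, ?_⟩
    rw [xMap_eq, Projectivization.mk_eq_mk_iff']
    refine ⟨(v 1)⁻¹, ?_⟩
    ext i
    fin_cases i
    · simp [xRep_some, div_eq_inv_mul]
    · simp [xRep_some, h1]

lemma doubleCover_surjective (W : WeierstrassCurve ℂ) [W.IsElliptic] (g : PGL(2, ℂ)) :
    Function.Surjective (doubleCover W g) :=
  (MulAction.surjective g).comp (xMap_surjective W)

/-- The fibre through `P` is `{P, -P}`, a single point exactly when `2P = 0`. -/
lemma branchLocus_eq (W : WeierstrassCurve ℂ) (g : PGL(2, ℂ)) :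
    branchLocus W g = doubleCover W g '' {P | 2 • P = 0} := by
  ext z
  constructor
  · rintro ⟨P, rfl, hP⟩
    refine ⟨P, ?_, rfl⟩
    have := hP (-P) (doubleCover_eq_iff.2 (Or.inr rfl))
    rw [Set.mem_ofPred_eq, two_nsmul]
    nth_rw 1 [← this]
    exact neg_add_cancel P
  · rintro ⟨P, hP, rfl⟩
    refine ⟨P, rfl, fun Q hQ => ?_⟩
    have hP' : -P = P := by
      rw [Set.mem_ofPred_eq, two_nsmul] at hP
      exact neg_eq_of_add_eq_zero_left hP
    rcases doubleCover_eq_iff.1 hQ with h | h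
    · exact h
    · exact h.trans hP'

lemma branchLocus_mul (W : WeierstrassCurve ℂ) (h g : PGL(2, ℂ)) :
    branchLocus W (h * g) = (h • ·) '' branchLocus W g := by
  rw [branchLocus_eq, branchLocus_eq, Set.image_image]
  exact Set.image_congr' fun P => mul_smul h g (xMap W P)

/-- The points over `z ∈ CP¹` have `x`-coordinates given by a fixed linear substitution. -/
lemma exists_rep_doubleCover (g : PGL(2, ℂ)) : ∃ p q r s : ℂ, p * s - q * r ≠ 0 ∧
    ∀ (W : WeierstrassCurve ℂ) (P : W.toAffine.Point), ∃ u : ℂ, u ≠ 0 ∧ (doubleCover W g P).rep =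
      u • ![p * P.xRep 0 + q * P.xRep 1, r * P.xRep 0 + s * P.xRep 1] := by
  obtain ⟨M, rfl⟩ := QuotientGroup.mk_surjective g
  refine ⟨M.val 0 0, M.val 0 1, M.val 1 0, M.val 1 1, ?_, fun W P => ?_⟩
  · rw [← Matrix.det_fin_two]
    exact (Matrix.isUnits_det_units M).ne_zero
  · have : doubleCover W (QuotientGroup.mk M) P = Projectivization.mk ℂ (M • P.xRep)
        ((smul_ne_zero_iff_ne M).2 P.xRep_ne_zero) := by
      change (Matrix.ProjGenLinGroup.mk M : PGL(2, ℂ)) • xMap W P = _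
      rw [xMap_eq, Projectivization.PGL.mk_smul_mk]
    rw [this]
    obtain ⟨u, hu⟩ := Projectivization.exists_smul_eq_mk_rep ℂ (M • P.xRep)
      ((smul_ne_zero_iff_ne M).2 P.xRep_ne_zero)
    refine ⟨u, u.ne_zero, ?_⟩
    rw [← hu]
    ext i
    fin_cases i <;> simp [Units.smul_def] <;> ring

lemma form_smul_coeffs (S : Conf 4) (t x y : ℂ) :
    BinaryQuartic.form (t • coeffs S) x y = t * MvPolynomial.eval ![x, y] (binForm S) := by
  rw [eval_eq_sum_coeff (binForm_isHomogeneous S)]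
  change _ = t * ∑ i : Fin 5, coeffs S i * (x ^ (i : ℕ) * y ^ (4 - i : ℕ))
  simp [Fin.sum_univ_five, BinaryQuartic.form]
  ring

lemma twoTorsion_equation {e y : ℂ} {h : W.toAffine.Nonsingular e y}
    (h2 : 2 • some e y h = 0) : 4 * e ^ 3 + W.b₂ * e ^ 2 + 2 * W.b₄ * e + W.b₆ = 0 := by
  have hneg : -some e y h = some e y h := by
    rw [neg_eq_iff_add_eq_zero, ← two_nsmul, h2]
  rw [neg_some] at hneg
  injection hneg with _ hy
  have heq := (W.toAffine.equation_iff e y).1 h.1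
  rw [negY] at hy
  rw [WeierstrassCurve.b₂, WeierstrassCurve.b₄, WeierstrassCurve.b₆]
  linear_combination (-4) * heq - (2 * y + W.a₁ * e + W.a₃) * hy

/-- In the coordinate `x` of `W` the points of `S` become infinity and the three two-torsion
abscissae, so the quartic must be proportional to `y (4x³ + b₂x²y + 2b₄xy² + b₆y³)`. -/
lemma exists_transform_eq_weierstrassQuartic [W.IsElliptic] {S : Conf 4}
    (hB : branchLocus W g = (S.val : Set CP1)) {p q r s : ℂ} (hd : p * s - q * r ≠ 0)
    (hrep : ∀ P : W.toAffine.Point, ∃ u : ℂ, u ≠ 0 ∧ (doubleCover W g P).rep =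
      u • ![p * P.xRep 0 + q * P.xRep 1, r * P.xRep 0 + s * P.xRep 1]) {t : ℂ} (ht : t ≠ 0) :
    ∃ c ≠ 0, BinaryQuartic.transform (t • coeffs S) p q r s =
      BinaryQuartic.weierstrassQuartic W c := by
  set w := BinaryQuartic.transform (t • coeffs S) p q r s with hw
  have hform (x y : ℂ) : BinaryQuartic.form w x y =
      t * MvPolynomial.eval ![p * x + q * y, r * x + s * y] (binForm S) := by
    rw [hw, BinaryQuartic.form_transform, form_smul_coeffs]
  have hzero {P : W.toAffine.Point} (hP : 2 • P = 0) :
      BinaryQuartic.form w (P.xRep 0) (P.xRep 1) = 0 := by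
    have hmem : doubleCover W g P ∈ (S.val : Set CP1) := by
      rw [← hB, branchLocus_eq]
      exact ⟨P, hP, rfl⟩
    obtain ⟨u, hu, h⟩ := hrep P
    have h0 := eval_binForm_eq_zero_iff.2 (Finset.mem_coe.1 hmem)
    rw [h, (binForm_isHomogeneous S).eval_const_smul, mul_eq_zero] at h0
    rw [hform, h0.resolve_left (pow_ne_zero 4 hu), mul_zero]
  have hw4 : w 4 = 0 := by
    simpa [BinaryQuartic.form] using hzero (P := 0) (nsmul_zero 2)
  have hroot {e : ℂ} (he : e ∈ W.xOfOrder 2) :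
      4 * e ^ 3 + W.b₂ * e ^ 2 + 2 * W.b₄ * e + W.b₆ = 0 ∧
      w 3 * e ^ 3 + w 2 * e ^ 2 + w 1 * e + w 0 = 0 := by
    obtain ⟨y, h, ho⟩ := he
    have h2 : 2 • some e y h = 0 := by rw [← ho, addOrderOf_nsmul_eq_zero]
    refine ⟨twoTorsion_equation h2, ?_⟩
    have := hzero h2
    simp [BinaryQuartic.form, hw4, xRep_some] at this
    linear_combination this
  have hcard : (W.xOfOrder 2).ncard = 3 := by
    rw [← WeierstrassCurve.ncard_addOrderOf_two, WeierstrassCurve.ncard_addOrderOf_two_eq_three]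
  obtain ⟨x, y, z, hxy, hxz, hyz, he⟩ := Set.ncard_eq_three.1 hcard
  obtain ⟨hx, hx'⟩ := hroot (e := x) (by simp [he])
  obtain ⟨hy, hy'⟩ := hroot (e := y) (by simp [he])
  obtain ⟨hz, hz'⟩ := hroot (e := z) (by simp [he])
  rw [← sub_ne_zero] at hxy hxz hyz
  -- Four times the cubic of `w` minus `w 3` times the two-division cubic has degree at most two and
  -- three distinct zeros. Its top coefficient is a second divided difference; the others follow by
  -- back substitution.
  have ha : 4 * w 2 - w 3 * W.b₂ = 0 := by
    apply mul_left_cancel₀ hxy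
    apply mul_left_cancel₀ hxz
    apply mul_left_cancel₀ hyz
    linear_combination (y - z) * (4 * hx' - w 3 * hx) - (x - z) * (4 * hy' - w 3 * hy) +
      (x - y) * (4 * hz' - w 3 * hz)
  have hb : 4 * w 1 - 2 * w 3 * W.b₄ = 0 := by
    apply mul_left_cancel₀ hxy
    linear_combination (4 * hx' - w 3 * hx) - (4 * hy' - w 3 * hy) - (x ^ 2 - y ^ 2) * ha
  have hc : 4 * w 0 - w 3 * W.b₆ = 0 := by
    linear_combination 4 * hx' - w 3 * hx - x ^ 2 * ha - x * hb
  have hwc : w = BinaryQuartic.weierstrassQuartic W (w 3 / 4) := by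
    ext i
    fin_cases i <;> simp [BinaryQuartic.weierstrassQuartic, hw4]
    · linear_combination hc / 4
    · linear_combination hb / 4
    · linear_combination ha / 4
    · ring
  -- If `w 3` were zero, `w` would be the zero form, and undoing the linear substitution would make
  -- `binForm S` vanish identically.
  refine ⟨w 3 / 4, fun h3 => ?_, hwc⟩
  have hb0 : binForm S ≠ 0 := Finset.prod_ne_zero_iff.2 fun p _ => linForm_ne_zero p
  apply hb0
  refine MvPolynomial.funext fun a => ?_
  have := hform ((s * a 0 - q * a 1) / (p * s - q * r)) ((p * a 1 - r * a 0) / (p * s - q * r))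
  rw [hwc, h3] at this
  have e0 : p * ((s * a 0 - q * a 1) / (p * s - q * r)) +
      q * ((p * a 1 - r * a 0) / (p * s - q * r)) = a 0 := by
    rw [← mul_div_assoc, ← mul_div_assoc, ← add_div, div_eq_iff hd]
    ring
  have e1 : r * ((s * a 0 - q * a 1) / (p * s - q * r)) +
      s * ((p * a 1 - r * a 0) / (p * s - q * r)) = a 1 := by
    rw [← mul_div_assoc, ← mul_div_assoc, ← add_div, div_eq_iff hd]
    ring
  rw [e0, e1] at this
  have ea : ![a 0, a 1] = a := by
    ext i
    fin_cases i <;> rfl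
  rw [ea] at this
  simpa [BinaryQuartic.form, BinaryQuartic.weierstrassQuartic, ht] using this.symm

end DoubleCover

/-! ### Existence of a double cover with given branch points. -/

section Existence

open WeierstrassCurve.Affine WeierstrassCurve.Affine.Point

lemma exists_smul_infinity_eq (z : CP1) : ∃ g : PGL(2, ℂ),
    g • (Projectivization.mk ℂ ![1, 0] (by simp) : CP1) = z := by
  obtain ⟨M, hM⟩ := MulAction.exists_smul_eq (Matrix.SpecialLinearGroup (Fin 2) ℂ)
    (Projectivization.mk ℂ ![1, 0] (by simp) : CP1) z
  refine ⟨.mk M, ?_⟩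
  rw [← hM]
  rfl

lemma exists_eq_mk_of_ne_infinity {z : CP1}
    (hz : z ≠ Projectivization.mk ℂ ![1, 0] (by simp)) :
    ∃ e : ℂ, z = Projectivization.mk ℂ ![e, 1] (by simp) := by
  induction z using Projectivization.ind with | h v hv
  simp only [ne_eq, Projectivization.mk_eq_mk_iff'] at hz ⊢
  have h1 : v 1 ≠ 0 := fun h1 => hz ⟨v 0, by ext i; fin_cases i <;> simp [h1]⟩
  exact ⟨v 0 / v 1, v 1, by ext i; fin_cases i <;> simp [mul_div_cancel₀, h1]⟩

/-- The elliptic curve `y² = (x - a) (x - b) (x - c)`. -/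
def legendreCurve (a b c : ℂ) : WeierstrassCurve ℂ :=
  ⟨0, -(a + b + c), 0, a * b + a * c + b * c, -(a * b * c)⟩

lemma isElliptic_legendreCurve {a b c : ℂ} (hab : a ≠ b) (hac : a ≠ c) (hbc : b ≠ c) :
    (legendreCurve a b c).IsElliptic := by
  rw [← sub_ne_zero] at hab hac hbc
  have h : (legendreCurve a b c).Δ = 16 * ((a - b) * (a - c) * (b - c)) ^ 2 := by
    simp only [legendreCurve, WeierstrassCurve.Δ, WeierstrassCurve.b₂, WeierstrassCurve.b₄,
      WeierstrassCurve.b₆, WeierstrassCurve.b₈]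
    ring
  refine ⟨?_⟩
  rw [h, isUnit_iff_ne_zero]
  exact mul_ne_zero (by norm_num) (pow_ne_zero 2 (mul_ne_zero (mul_ne_zero hab hac) hbc))

lemma branchLocus_legendreCurve {a b c : ℂ} [(legendreCurve a b c).IsElliptic] :
    branchLocus (legendreCurve a b c) 1 = {Projectivization.mk ℂ ![1, 0] (by simp),
      Projectivization.mk ℂ ![a, 1] (by simp), Projectivization.mk ℂ ![b, 1] (by simp),
      Projectivization.mk ℂ ![c, 1] (by simp)} := by
  have hroot {e : ℂ} (he : (e - a) * (e - b) * (e - c) = 0) :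
      Projectivization.mk ℂ ![e, 1] (by simp) ∈ branchLocus (legendreCurve a b c) 1 := by
    have hns : (legendreCurve a b c).toAffine.Nonsingular e 0 := by
      rw [← equation_iff_nonsingular, equation_iff]
      simp only [legendreCurve]
      linear_combination -he
    rw [branchLocus_eq]
    refine ⟨some e 0 hns, ?_, ?_⟩
    · rw [Set.mem_ofPred_eq, two_nsmul, ← neg_eq_iff_add_eq_zero, neg_some]
      simp [negY, legendreCurve]
    · rw [doubleCover, one_smul]
      rfl
  ext z
  simp only [Set.mem_insert_iff, Set.mem_singleton_iff]
  constructor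
  · rw [branchLocus_eq]
    rintro ⟨P, hP, rfl⟩
    rw [doubleCover, one_smul]
    rcases P with _ | ⟨x, y, h⟩
    · exact Or.inl rfl
    · have := twoTorsion_equation hP
      have hx : (x - a) * (x - b) * (x - c) = 0 := by
        simp only [legendreCurve, WeierstrassCurve.b₂, WeierstrassCurve.b₄,
          WeierstrassCurve.b₆] at this
        linear_combination this / 4
      rw [mul_eq_zero, mul_eq_zero, sub_eq_zero, sub_eq_zero, sub_eq_zero] at hx
      rcases hx with (rfl | rfl) | rfl <;> simp [xMap]
  · rintro (rfl | rfl | rfl | rfl)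
    · rw [branchLocus_eq]
      refine ⟨0, nsmul_zero 2, ?_⟩
      rw [doubleCover, one_smul]
      rfl
    all_goals exact hroot (by ring)

/-- Every configuration of four points is the branch locus of a double cover by an elliptic
curve. -/
theorem exists_branchLocus_eq (S : Conf 4) : ∃ (W : WeierstrassCurve ℂ) (g : PGL(2, ℂ)),
    W.IsElliptic ∧ branchLocus W g = (S.val : Set CP1) := by
  classical
  obtain ⟨z, hz⟩ : S.val.Nonempty := Finset.card_pos.1 (by rw [S.property]; norm_num)
  obtain ⟨g, rfl⟩ := exists_smul_infinity_eq z
  set T := (S.act g⁻¹).val with hT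
  have hmem : (Projectivization.mk ℂ ![1, 0] (by simp) : CP1) ∈ T := by
    rw [hT, Conf.act, Finset.mem_map]
    exact ⟨_, hz, inv_smul_smul g _⟩
  have hcard : (T.erase (Projectivization.mk ℂ ![1, 0] (by simp))).card = 3 := by
    rw [Finset.card_erase_of_mem hmem, hT, (S.act g⁻¹).property]
  obtain ⟨x, y, z, hxy, hxz, hyz, he⟩ := Finset.card_eq_three.1 hcard
  have hne {u : CP1} (hu : u ∈ ({x, y, z} : Finset CP1)) :
      ∃ e : ℂ, u = Projectivization.mk ℂ ![e, 1] (by simp) :=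
    exists_eq_mk_of_ne_infinity (Finset.ne_of_mem_erase (he ▸ hu))
  obtain ⟨a, rfl⟩ := hne (u := x) (by simp)
  obtain ⟨b, rfl⟩ := hne (u := y) (by simp)
  obtain ⟨c, rfl⟩ := hne (u := z) (by simp)
  have := isElliptic_legendreCurve (a := a) (b := b) (c := c) (by rintro rfl; exact hxy rfl)
    (by rintro rfl; exact hxz rfl) (by rintro rfl; exact hyz rfl)
  refine ⟨legendreCurve a b c, g, this, ?_⟩
  have hT' : branchLocus (legendreCurve a b c) 1 = (T : Set CP1) := by
    rw [branchLocus_legendreCurve, ← Finset.insert_erase hmem, he]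
    simp
  rw [← mul_one g, branchLocus_mul, hT', hT, Conf.act, Finset.coe_map, Set.image_image]
  simp

end Existence

end ConfCP1

/-! ### The sections. -/

namespace ConfCP1

/-- A set of points given by the orders of their doubles is saturated for the double cover. -/
lemma mem_image_doubleCover_iff {W : WeierstrassCurve ℂ} {g : PGL(2, ℂ)} {O : Set ℕ}
    {P : W.toAffine.Point} :
    doubleCover W g P ∈ doubleCover W g '' {P | addOrderOf (2 • P) ∈ O} ↔
      addOrderOf (2 • P) ∈ O := by
  refine ⟨fun ⟨Q, hQ, h⟩ => ?_, fun h => ⟨P, h, rfl⟩⟩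
  rcases doubleCover_eq_iff.1 h with rfl | rfl
  · exact hQ
  · simpa using hQ

lemma finite_addOrderOf_two_nsmul_mem (W : WeierstrassCurve ℂ) [W.IsElliptic] {O : Finset ℕ}
    (hO : ∀ d ∈ O, 2 ≤ d) : {P : W.toAffine.Point | addOrderOf (2 • P) ∈ O}.Finite := by
  refine (O.finite_toSet.biUnion fun d hd => W.finite_torsion (n := d * 2) fun h => ?_).subset
    fun P hP => Set.mem_biUnion (Finset.mem_coe.2 hP) ?_
  · have := hO d hd
    lia
  · rw [Set.mem_ofPred_eq, mul_smul, addOrderOf_nsmul_eq_zero]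

lemma ncard_image_doubleCover (W : WeierstrassCurve ℂ) [W.IsElliptic] (g : PGL(2, ℂ))
    {O : Finset ℕ} (hO : ∀ d ∈ O, 2 ≤ d) :
    {P : W.toAffine.Point | addOrderOf (2 • P) ∈ O}.ncard =
      2 * (doubleCover W g '' {P | addOrderOf (2 • P) ∈ O}).ncard := by
  refine WeierstrassCurve.ncard_eq_two_mul_ncard_image _ (fun P Q => doubleCover_eq_iff)
    (finite_addOrderOf_two_nsmul_mem W hO) (fun P hP => by simpa using hP) fun P hP h => ?_
  rw [Set.mem_ofPred_eq, h, addOrderOf_zero] at hP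
  have := hO 1 hP
  lia

lemma disjoint_branchLocus_image {W : WeierstrassCurve ℂ} {g : PGL(2, ℂ)} {O : Finset ℕ}
    (hO : ∀ d ∈ O, 2 ≤ d) :
    Disjoint (branchLocus W g) (doubleCover W g '' {P | addOrderOf (2 • P) ∈ O}) := by
  rw [branchLocus_eq, Set.disjoint_left]
  rintro _ ⟨P, hP, rfl⟩ h
  have := mem_image_doubleCover_iff (O := O).1 h
  rw [Set.mem_ofPred_eq] at hP
  rw [hP, addOrderOf_zero] at this
  have := hO 1 this
  lia

/-- The images of points of given orders under a double cover branched over `S` are the zeros of a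
form whose coefficients are polynomials in those of `S`. -/
theorem exists_form_eq_zero_iff {O : Finset ℕ} (hO : ∀ d ∈ O, 2 ≤ d) :
    ∃ (N : ℕ) (G : MvPolynomial (Fin 2) (MvPolynomial (Fin 5) ℂ)), G.IsHomogeneous N ∧
      ∀ (S : Conf 4) (W : WeierstrassCurve ℂ) (g : PGL(2, ℂ)), W.IsElliptic →
        branchLocus W g = (S.val : Set CP1) →
        (doubleCover W g '' {P | addOrderOf (2 • P) ∈ O}).ncard = N ∧
        ∀ t : ℂ, t ≠ 0 → ∀ z : CP1, MvPolynomial.eval z.rep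
          (MvPolynomial.map (MvPolynomial.eval (t • coeffs S)) G) = 0 ↔
            z ∈ doubleCover W g '' {P | addOrderOf (2 • P) ∈ O} := by
  obtain ⟨N, G, hG, h⟩ := BinaryQuartic.exists_covariantForm (F := ℂ) hO
  refine ⟨N, G, hG, fun S W g hW hB => ?_⟩
  obtain ⟨p, q, r, s, hd, hrep⟩ := exists_rep_doubleCover g
  refine ⟨?_, fun t ht z => ?_⟩
  · obtain ⟨c, hc, hw⟩ := exists_transform_eq_weierstrassQuartic hB hd (hrep W) one_ne_zero
    have := (h _ W p q r s c hW hc hd hw).1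
    rw [ncard_image_doubleCover W g hO] at this
    lia
  · obtain ⟨c, hc, hw⟩ := exists_transform_eq_weierstrassQuartic hB hd (hrep W) ht
    obtain ⟨P, rfl⟩ := doubleCover_surjective W g z
    obtain ⟨u, hu, hP⟩ := hrep W P
    rw [hP, (hG.map _).eval_const_smul, mul_eq_zero, or_iff_right (pow_ne_zero N hu),
      (h _ W p q r s c hW hc hd hw).2 P]
    exact (mem_image_doubleCover_iff (O := O)).symm

/-- The images of the points whose doubles have orders in `O`, under any double cover branched over
`S`, are the new points of an algebraic, conformally invariant section. -/
theorem exists_section_of_orders {m : ℕ} {O : Finset ℕ} (hO : ∀ d ∈ O, 2 ≤ d)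
    (hm : ∀ W : WeierstrassCurve ℂ, W.IsElliptic →
      {P : W.toAffine.Point | addOrderOf (2 • P) ∈ O}.ncard = 2 * m) :
    ∃ σ : Conf 4 → Conf₂ 4 m, IsSection σ ∧ IsAlgebraic σ ∧ IsConformallyInvariant σ ∧
      NewPointsAre σ (fun _ P => addOrderOf (2 • P) ∈ O) := by
  obtain ⟨N, G, hG, hN⟩ := exists_form_eq_zero_iff hO
  choose W g hW hB using exists_branchLocus_eq
  have hcard (S : Conf 4) := ncard_image_doubleCover (W S) (g S) hO
  have hfin (S : Conf 4) :=
    (finite_addOrderOf_two_nsmul_mem (W S) hO).image (doubleCover (W S) (g S))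
  -- Both images are the zero set of the one form `G`, specialized at `coeffs S`.
  have huniq {S : Conf 4} {W₁ W₂ : WeierstrassCurve ℂ} {g₁ g₂ : PGL(2, ℂ)} (h₁ : W₁.IsElliptic)
      (h₂ : W₂.IsElliptic) (hB₁ : branchLocus W₁ g₁ = (S.val : Set CP1))
      (hB₂ : branchLocus W₂ g₂ = (S.val : Set CP1)) :
      doubleCover W₁ g₁ '' {P | addOrderOf (2 • P) ∈ O} =
        doubleCover W₂ g₂ '' {P | addOrderOf (2 • P) ∈ O} := by
    ext z
    rw [← (hN S W₁ g₁ h₁ hB₁).2 1 one_ne_zero, (hN S W₂ g₂ h₂ hB₂).2 1 one_ne_zero]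
  let new (S : Conf 4) : Conf m := ⟨(hfin S).toFinset, by
    rw [← Set.ncard_eq_toFinset_card _ (hfin S)]
    have := hm (W S) (hW S)
    have := hcard S
    lia⟩
  have hnew (S : Conf 4) : ((new S).val : Set CP1) =
      doubleCover (W S) (g S) '' {P | addOrderOf (2 • P) ∈ O} := (hfin S).coe_toFinset
  let σ (S : Conf 4) : Conf₂ 4 m := ⟨(S, new S), by
    rw [← Finset.disjoint_coe, hnew, ← hB S]
    exact disjoint_branchLocus_image hO⟩
  refine ⟨σ, fun S => rfl, ⟨?_, ?_⟩, fun h S => ?_, fun S => ⟨⟨W S, g S, hW S, hB S⟩, ?_⟩⟩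
  · exact isRegular_of_eval_eq (f := id) MvPolynomial.X fun S t ht => ⟨t, ht, fun j => by simp⟩
  · intro S₀
    -- The degree is compared with `m` at the configuration `S₀`, around which regularity is being
    -- proved.
    obtain rfl : N = m := by
      rw [← (hN S₀ _ _ (hW S₀) (hB S₀)).1, ← hnew, Set.ncard_coe_finset, (new S₀).property]
    refine isRegular_of_eval_eq (f := new)
      (fun j => G.coeff (Finsupp.single 0 (j : ℕ) + Finsupp.single 1 (N - j))) (fun S t ht => ?_) S₀
    have hz := (hN S _ _ (hW S) (hB S)).2 t ht
    obtain ⟨c, hc⟩ := exists_eq_C_mul_binForm (S := new S) (hG.map _) fun z hz' =>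
      (hz z).2 (hnew S ▸ Finset.mem_coe.2 hz')
    refine ⟨c, ?_, fun j => ?_⟩
    -- The form does not vanish at the image of the origin, whose double has order `1`, so the
    -- constant is nonzero.
    · rintro rfl
      have h0 := (mem_image_doubleCover_iff (O := O)).1
        ((hz (doubleCover (W S) (g S) 0)).1 (by rw [hc]; simp))
      rw [nsmul_zero, addOrderOf_zero] at h0
      have := hO 1 h0
      lia
    · have := congrArg (MvPolynomial.coeff (Finsupp.single 0 (j : ℕ) + Finsupp.single 1 (N - j))) hc
      rwa [MvPolynomial.coeff_map, MvPolynomial.coeff_C_mul] at this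
  · refine Subtype.ext (Prod.ext rfl (Subtype.ext (Finset.coe_injective ?_)))
    change ((new (S.act h)).val : Set CP1) = (((new S).act h).val : Set CP1)
    -- The chosen cover for `h • S` is unrelated to the one for `S`, but `h * g S` also gives a
    -- cover branched over `h • S`, and the image does not depend on the cover.
    have hB' : branchLocus (W S) (h * g S) = ((S.act h).val : Set CP1) := by
      rw [branchLocus_mul, hB, Conf.act, Finset.coe_map]
      rfl
    rw [hnew, huniq (hW _) (hW S) (hB _) hB', Conf.act, Finset.coe_map, hnew, Set.image_image]
    exact Set.image_congr' fun P => mul_smul h (g S) (xMap (W S) P)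
  · intro W' g' hW' hB'
    change ((new S).val : Set CP1) = _
    rw [hnew, huniq (hW S) hW' (hB S) hB']

/-- `ZMod 0` is `ℤ`, and infinitely many elements of `ℤ²` have infinite order, so `Nat.card` takes
its default value. This rules out `k = 0` when `m` is positive. -/
lemma numPrimitive_zero : numPrimitive 0 = 0 := by
  have : Infinite {v : ZMod 0 × ZMod 0 // addOrderOf v = 0} := by
    refine Infinite.of_injective
      (fun n : ℕ => ⟨((n + 1 : ℤ), (0 : ℤ)), addOrderOf_eq_zero_iff'.2 fun d hd h => ?_⟩) ?_
    · have h1 : (d : ℤ) * (n + 1) = 0 := by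
        rw [← nsmul_eq_mul]
        exact congrArg Prod.fst h
      have : (0 : ℤ) < d * (n + 1) := by positivity
      lia
    · intro a b h
      have : ((a + 1 : ℤ)) = b + 1 := congrArg (fun v => v.val.1) h
      lia
  exact Nat.card_eq_zero_of_infinite

/-- If `a` has odd order, doubling preserves it, and it is neither `2k` nor `4k`; otherwise doubling
halves the order, infinite order being `0`. The evenness of `2k` is what makes "order exactly `4k`"
a condition on the double. -/
lemma addOrderOf_two_nsmul_eq_iff {A : Type*} [AddMonoid A] (k : ℕ) (a : A) :
    addOrderOf (2 • a) = 2 * k ↔ addOrderOf a = 4 * k := by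
  rw [addOrderOf_nsmul' a two_ne_zero]
  rcases Nat.even_or_odd (addOrderOf a) with h | h
  · rw [Nat.gcd_eq_right h.two_dvd]
    have := h.two_dvd
    lia
  · rw [(Nat.coprime_two_right.2 h : Nat.gcd _ 2 = 1), Nat.div_one]
    obtain ⟨c, hc⟩ := h
    lia

lemma addOrderOf_two_nsmul_mem_iff {A : Type*} [AddMonoid A] {k : ℕ} (hk : k ≠ 0) (a : A) :
    addOrderOf (2 • a) ∈ k.divisors.erase 1 ↔ (2 * k) • a = 0 ∧ 2 • a ≠ 0 := by
  rw [Finset.mem_erase, Nat.mem_divisors, ne_eq, AddMonoid.addOrderOf_eq_one_iff,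
    addOrderOf_dvd_iff_nsmul_eq_zero, mul_comm 2 k, mul_smul, and_iff_left hk, and_comm]

end ConfCP1

theorem mainTheorem4 (k m : ℕ) (hm : 0 < m) :
    ((m : ℤ) = 2 * (k : ℤ) ^ 2 - 2 →
      ∃ σ : ConfCP1.Conf 4 → ConfCP1.Conf₂ 4 m,
        ConfCP1.IsSection σ ∧ ConfCP1.IsAlgebraic σ ∧ ConfCP1.IsConformallyInvariant σ ∧
        ConfCP1.NewPointsAre σ (fun _ P => (2 * k) • P = 0 ∧ 2 • P ≠ 0)) ∧
    ((m : ℚ) = (ConfCP1.numPrimitive (4 * k) : ℚ) / 2 →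
      ∃ σ : ConfCP1.Conf 4 → ConfCP1.Conf₂ 4 m,
        ConfCP1.IsSection σ ∧ ConfCP1.IsAlgebraic σ ∧ ConfCP1.IsConformallyInvariant σ ∧
        ConfCP1.NewPointsAre σ (fun _ P => addOrderOf P = 4 * k)) := by
  constructor
  · intro hk
    have hk0 : k ≠ 0 := by
      rintro rfl
      norm_num at hk
      lia
    simp only [← ConfCP1.addOrderOf_two_nsmul_mem_iff hk0]
    have hO : ∀ d ∈ k.divisors.erase 1, 2 ≤ d := fun d hd => by
      have := Nat.pos_of_mem_divisors (Finset.mem_of_mem_erase hd)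
      have := Finset.ne_of_mem_erase hd
      lia
    refine ConfCP1.exists_section_of_orders hO fun W hW => ?_
    have h1 := ncard_torsion_eq_sum_ncard_addOrderOf hk0 (W.finite_torsion hk0)
    rw [W.ncard_torsion hk0, ← Finset.add_sum_erase _ _ (Nat.one_mem_divisors.2 hk0),
      WeierstrassCurve.ncard_addOrderOf_one] at h1
    rw [BinaryQuartic.ncard_addOrderOf_two_nsmul_mem W hO]
    zify at h1 ⊢
    -- Of the `k²` points killed by `k` all but the origin count, and each has four halves: `4 (k² -
    -- 1) = 2m`.
    linear_combination 4 * (-h1) - 2 * hk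
  · intro hk
    have hk0 : k ≠ 0 := by
      rintro rfl
      rw [mul_zero, ConfCP1.numPrimitive_zero, Nat.cast_zero, zero_div, Nat.cast_eq_zero] at hk
      lia
    have hiff (W : WeierstrassCurve ℂ) (P : W.toAffine.Point) :
        addOrderOf P = 4 * k ↔ addOrderOf (2 • P) ∈ ({2 * k} : Finset ℕ) := by
      rw [Finset.mem_singleton, ConfCP1.addOrderOf_two_nsmul_eq_iff]
    simp only [hiff]
    refine ConfCP1.exists_section_of_orders (fun d hd => ?_) fun W hW => ?_
    · rw [Finset.mem_singleton.1 hd]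
      lia
    · simp only [← hiff]
      rw [W.ncard_addOrderOf (mul_ne_zero four_ne_zero hk0)]
      rw [eq_div_iff two_ne_zero] at hk
      have : m * 2 = ConfCP1.numPrimitive (4 * k) := by exact_mod_cast hk
      lia
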